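/- Let $T$ be a torus over a number field $k$, with adele ring $\mathbb{A}_k$. For a finite set $S$ of finite places of $k$ put $T(k_S)=\prod_{v\in S}T(k_v)$, and let $T(k_S)_c$ denote its maximal compact subgroup; $T(k_S)$ is regarded as a subgroup of $T(\mathbb{A}_k)$ by taking components $1$ at all places outside $S$. A character of $T(\mathbb{A}_k)$ is called unramified at a finite place $v$ if it is trivial on the maximal compact subgroup $T(k_v)_c$ of $T(k_v)$, and unramified outside $S$ if it is unramified at every finite place $v\notin S$ (no condition is imposed at the infinite places). All characters are continuous. (1) Let $S$ be a finite set of finite places of $k$ and let $\chi_S\colon T(k_S)_c\to\mathbb{C}^\times$ be a character. Then there exists a unitary character $\chi'$ of $T(\mathbb{A}_k)/T(k)$ which restricts to $\chi_S$ on $T(k_S)_c$ and is unramified outside $S$. (2) For a torus $T'$ over a field $F$, let $A_{T'}$ denote the maximal $F$-split subtorus of $T'$. Let $u_0$ be a finite place of $k$ such that $A_{T_{u_0}}=A_T\times_k k_{u_0}$, where $T_{u_0}=T\times_k k_{u_0}$. Let $\chi_{u_0}$ be a unitary character of $T(k_{u_0})$. Then there exists a unitary character $\chi$ of $T(\mathbb{A}_k)/T(k)$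 which restricts to $\chi_{u_0}$ on $T(k_{u_0})$ and is unramified outside $\{u_0\}$. -/

import Mathlib

open scoped TensorProduct NumberField

noncomputable section

namespace TorusCharacters

open IsDedekindDomain NumberField WithConv

/-! ### Affine group schemes and tori

An affine group scheme over a field `k` is given by its coordinate ring, a commutative Hopf
algebra `A` over `k`. -/

/-- The coordinate ring of the split torus of dimension `n` over `k`: the group algebra of the
character lattice `ℤⁿ`, with its Hopf algebra structure in which every character is group-like. -/
abbrev SplitTorusRing (k : Type*) [Field k] (n : ℕ) : Type _ :=
  AddMonoidAlgebra k (Fin n → ℤ)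

/-- `Spec A` is a torus over `k`: over an algebraic closure of `k` it becomes isomorphic, as a group
scheme, to a split torus. -/
def IsTorus (k A : Type*) [Field k] [CommRing A] [HopfAlgebra k A] : Prop :=
  ∃ n : ℕ, Nonempty
    ((AlgebraicClosure k ⊗[k] A) ≃ₐc[AlgebraicClosure k] SplitTorusRing (AlgebraicClosure k) n)

/-- The closed subscheme of `Spec A` cut out by the ideal `I` is a subgroup scheme which is a
split torus over `k`. -/
def IsSplitSubtorus (k : Type*) {A : Type*} [Field k] [CommRing A] [HopfAlgebra k A]
    (I : Ideal A) : Prop :=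
  ∃ (r : ℕ) (π : A →ₐc[k] SplitTorusRing k r),
    Function.Surjective π ∧ RingHom.ker (π : A →ₐ[k] SplitTorusRing k r) = I

/-- The ideal `I` cuts out the maximal split subtorus of the torus `Spec A`: the split subtorus that
contains all the others. (Inclusion of closed subschemes reverses inclusion of ideals.) -/
def IsMaximalSplitSubtorus (k : Type*) {A : Type*} [Field k] [CommRing A] [HopfAlgebra k A]
    (I : Ideal A) : Prop :=
  IsLeast {J : Ideal A | IsSplitSubtorus k J} I

/-- For a torus `T = Spec A` over `k` with maximal split subtorus `A_T`, and an extension `L` of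
`k`: the base change `A_T ×_k L` is the maximal split subtorus of `T ×_k L`. -/
def SplitPartCompatible (k A L : Type*) [Field k] [CommRing A] [HopfAlgebra k A]
    [Field L] [Algebra k L] : Prop :=
  ∃ I : Ideal A, IsMaximalSplitSubtorus k I ∧
    IsMaximalSplitSubtorus L
      (I.map (Algebra.TensorProduct.includeRight : A →ₐ[k] L ⊗[k] A))

/-! ### Groups of points -/

/-- The group `T(R)` of `R`-points of `T = Spec A`. -/
def Points (k A R : Type*) [Field k] [CommRing A] [HopfAlgebra k A] [CommRing R] [Algebra k R] :
    Type _ :=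
  WithConv (A →ₐ[k] R)

namespace Points

variable {k A R R' : Type*} [Field k] [CommRing A] [HopfAlgebra k A]
  [CommRing R] [Algebra k R] [CommRing R'] [Algebra k R']

/-- The point given by a homomorphism of `k`-algebras `A → R`. -/
def ofAlgHom (f : A →ₐ[k] R) : Points k A R := WithConv.toConv f

/-- A point as a homomorphism of `k`-algebras `A → R`. -/
def toAlgHom (x : Points k A R) : A →ₐ[k] R := WithConv.ofConv x

/-- The value of a function `a ∈ A` on `T` at a point. -/
def eval (x : Points k A R) (a : A) : R := x.toAlgHom a

theorem eval_injective : Function.Injective (eval : Points k A R → A → R) := fun _ _ h =>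
  WithConv.ofConv_injective (AlgHom.ext fun a => congrFun h a)

/-- The multiplication of points comes from the comultiplication of `A`, the unit from the counit. -/
instance : Monoid (Points k A R) := inferInstanceAs (Monoid (WithConv (A →ₐ[k] R)))

theorem eval_one (a : A) :
    (1 : Points k A R).eval a = algebraMap k R (Coalgebra.counit (R := k) a) := rfl

theorem eval_mul (x y : Points k A R) (a : A) :
    (x * y).eval a = Algebra.TensorProduct.lift x.toAlgHom y.toAlgHom
      (fun _ _ ↦ .all ..) (Coalgebra.comul (R := k) a) :=
  AlgHom.convMul_apply (R := k) (C := A) (A := R) x y a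

/-- Inversion of points comes from the antipode of `A`. -/
instance : Group (Points k A R) where
  inv x := ofAlgHom (x.toAlgHom.comp (HopfAlgebra.antipodeAlgHom k A))
  inv_mul_cancel x := by
    apply eval_injective
    funext a
    refine (eval_mul _ x a).trans ?_
    rw [eval_one]
    have h : ∀ z : A ⊗[k] A,
        Algebra.TensorProduct.lift (x.toAlgHom.comp (HopfAlgebra.antipodeAlgHom k A))
          x.toAlgHom (fun _ _ ↦ .all ..) z =
        x.toAlgHom (LinearMap.mul' k A ((HopfAlgebra.antipode k).rTensor A z)) := by
      intro z
      induction z with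
      | zero => simp
      | add y z hy hz => simp only [map_add, hy, hz]
      | tmul b c => simp
    refine (h _).trans ?_
    rw [HopfAlgebra.mul_antipode_rTensor_comul_apply]
    exact AlgHom.commutes _ _

/-- The topology of `T(R)` for a topological ring `R`: the coarsest one for which every function
`a ∈ A` is continuous on `T(R)`. When `A` is generated by `a₁, …, aₙ`, it is the subspace topology
for the embedding `(a₁, …, aₙ)` of `T(R)` in `Rⁿ`. -/
instance [TopologicalSpace R] : TopologicalSpace (Points k A R) :=
  TopologicalSpace.induced eval inferInstance

/-- The homomorphism `T(R) → T(R')` induced by a homomorphism of `k`-algebras `R → R'`. -/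
def map (φ : R →ₐ[k] R') : Points k A R →* Points k A R' where
  toFun x := ofAlgHom (φ.comp x.toAlgHom)
  map_one' := by
    apply eval_injective
    funext a
    exact φ.commutes _
  map_mul' x y := congrArg WithConv.toConv (AlgHom.comp_convMul_distrib (R := k) φ x y)

theorem eval_map (φ : R →ₐ[k] R') (x : Points k A R) (a : A) :
    (map φ x).eval a = φ (x.eval a) := rfl

end Points

/-! ### The maximal compact subgroup -/

/-- The subgroup generated by all compact subgroups of `G`. If `G` has a largest compact
subgroup, as the group of points of a torus over a product of `p`-adic fields has, this is it. -/
def maxCompactSubgroup (G : Type*) [Group G] [TopologicalSpace G] : Subgroup G :=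
  sSup {K : Subgroup G | IsCompact (K : Set G)}

/-! ### Local and adelic points over a number field -/

section NumberField

variable (k A : Type*) [Field k] [NumberField k] [CommRing A] [HopfAlgebra k A]

/-- The finite places of the number field `k`. -/
abbrev FinitePlaces : Type _ := HeightOneSpectrum (𝓞 k)

/-- `T(k_v)` for a finite place `v`. -/
abbrev LocalPoints (v : FinitePlaces k) : Type _ := Points k A (v.adicCompletion k)

/-- `T(k_S) = ∏_{v ∈ S} T(k_v)` for a finite set `S` of finite places. -/
abbrev SemilocalPoints (S : Finset (FinitePlaces k)) : Type _ := ∀ v : S, LocalPoints k A v.1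

/-- `T(𝔸_k)`, with the full adele ring (infinite places included). -/
abbrev AdelicPoints : Type _ := Points k A (AdeleRing (𝓞 k) k)

/-- The diagonal homomorphism `T(k) → T(𝔸_k)`. -/
def globalToAdelic : Points k A k →* AdelicPoints k A :=
  Points.map (Algebra.ofId k (AdeleRing (𝓞 k) k))

variable {k A}

/-- The adelic point with component `y v` at each finite place `v` and component `1` at each
infinite place, for a family `y` with almost all members equal to `1`. -/
def adelicOfFamily (y : ∀ v : FinitePlaces k, LocalPoints k A v)
    (hy : {v | y v ≠ 1}.Finite) : AdelicPoints k A :=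
  Points.ofAlgHom
    { toFun := fun a =>
        ((algebraMap k (InfiniteAdeleRing k) (Coalgebra.counit (R := k) a),
          ⟨fun v => (y v).eval a, by
            have h1 := (algebraMap k (FiniteAdeleRing (𝓞 k) k)
              (Coalgebra.counit (R := k) a)).2
            filter_upwards [h1, hy.compl_mem_cofinite] with v hv hv'
            have hyv : y v = 1 := by simpa using hv'
            rw [hyv]
            exact hv⟩) : InfiniteAdeleRing k × FiniteAdeleRing (𝓞 k) k)
      map_one' := by
        refine Prod.ext ?_ (Subtype.ext (funext fun v => map_one (y v).toAlgHom))
        change algebraMap k (InfiniteAdeleRing k) (Coalgebra.counit (R := k) (1 : A)) = 1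
        rw [Bialgebra.counit_one, map_one]
      map_mul' := fun a b => by
        refine Prod.ext ?_ (Subtype.ext (funext fun v => map_mul (y v).toAlgHom a b))
        change algebraMap k (InfiniteAdeleRing k) (Coalgebra.counit (R := k) (a * b)) =
          algebraMap k _ _ * algebraMap k _ _
        rw [Bialgebra.counit_mul, map_mul]
      map_zero' := by
        refine Prod.ext ?_ (Subtype.ext (funext fun v => map_zero (y v).toAlgHom))
        change algebraMap k (InfiniteAdeleRing k) (Coalgebra.counit (R := k) (0 : A)) = 0
        rw [map_zero, map_zero]
      map_add' := fun a b => by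
        refine Prod.ext ?_ (Subtype.ext (funext fun v => map_add (y v).toAlgHom a b))
        change algebraMap k (InfiniteAdeleRing k) (Coalgebra.counit (R := k) (a + b)) =
          algebraMap k _ _ + algebraMap k _ _
        rw [map_add, map_add]
      commutes' := fun c => by
        refine Prod.ext ?_
          (Subtype.ext (funext fun v => AlgHom.commutes (y v).toAlgHom c))
        change algebraMap k (InfiniteAdeleRing k)
          (Coalgebra.counit (R := k) (algebraMap k A c)) = algebraMap k (InfiniteAdeleRing k) c
        rw [Bialgebra.counit_algebraMap] }

/-- The projection `𝔸_k → k_v` for a finite place `v`. -/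
def adeleFiniteProj (v : FinitePlaces k) : AdeleRing (𝓞 k) k →ₐ[k] v.adicCompletion k where
  toFun x := x.2 v
  map_one' := rfl
  map_mul' _ _ := rfl
  map_zero' := rfl
  map_add' _ _ := rfl
  commutes' _ := rfl

/-- The projection `𝔸_k → ∏_{v ∣ ∞} k_v`. -/
def adeleInfiniteProj : AdeleRing (𝓞 k) k →ₐ[k] InfiniteAdeleRing k where
  toFun x := x.1
  map_one' := rfl
  map_mul' _ _ := rfl
  map_zero' := rfl
  map_add' _ _ := rfl
  commutes' _ := rfl

/-- An adelic point is determined by its components. -/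
theorem adelicPoints_ext {x y : AdelicPoints k A}
    (h₁ : Points.map adeleInfiniteProj x = Points.map adeleInfiniteProj y)
    (h₂ : ∀ v, Points.map (adeleFiniteProj v) x = Points.map (adeleFiniteProj v) y) : x = y := by
  apply Points.eval_injective
  funext a
  refine Prod.ext ?_ (FiniteAdeleRing.ext k fun v => ?_)
  · exact congrArg (fun z => z.eval a) h₁
  · exact congrArg (fun z => z.eval a) (h₂ v)

theorem map_adeleFiniteProj_adelicOfFamily (y : ∀ v : FinitePlaces k, LocalPoints k A v)
    (hy : {v | y v ≠ 1}.Finite) (v : FinitePlaces k) :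
    Points.map (adeleFiniteProj v) (adelicOfFamily y hy) = y v := rfl

theorem map_adeleInfiniteProj_adelicOfFamily (y : ∀ v : FinitePlaces k, LocalPoints k A v)
    (hy : {v | y v ≠ 1}.Finite) :
    Points.map adeleInfiniteProj (adelicOfFamily y hy) = 1 := rfl

open Classical in
/-- The inclusion `T(k_S) → T(𝔸_k)`: components `1` at all places outside `S`. -/
def semilocalToAdelic (S : Finset (FinitePlaces k)) :
    SemilocalPoints k A S →* AdelicPoints k A where
  toFun x := adelicOfFamily (fun v => if h : v ∈ S then x ⟨v, h⟩ else 1)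
    (S.finite_toSet.subset fun v hv => by
      by_contra h
      exact hv (dif_neg h))
  map_one' := by
    refine adelicPoints_ext ?_ fun v => ?_
    · rw [map_adeleInfiniteProj_adelicOfFamily, map_one]
    · rw [map_adeleFiniteProj_adelicOfFamily, map_one]
      split_ifs <;> rfl
  map_mul' x y := by
    refine adelicPoints_ext ?_ fun v => ?_
    · simp only [map_mul, map_adeleInfiniteProj_adelicOfFamily, mul_one]
    · simp only [map_mul, map_adeleFiniteProj_adelicOfFamily]
      split_ifs <;> simp

open Classical in
/-- The inclusion `T(k_v) → T(𝔸_k)` for a finite place `v`: components `1` at all other places. -/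
def localToAdelic (v : FinitePlaces k) : LocalPoints k A v →* AdelicPoints k A where
  toFun x := adelicOfFamily (Pi.mulSingle v x)
    ((Set.finite_singleton v).subset fun w hw => by
      by_contra h
      exact hw (Pi.mulSingle_eq_of_ne h x))
  map_one' := by
    refine adelicPoints_ext ?_ fun w => ?_
    · rw [map_adeleInfiniteProj_adelicOfFamily, map_one]
    · rw [map_adeleFiniteProj_adelicOfFamily, map_one, Pi.mulSingle_one, Pi.one_apply]
  map_mul' x y := by
    refine adelicPoints_ext ?_ fun w => ?_
    · simp only [map_mul, map_adeleInfiniteProj_adelicOfFamily, mul_one]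
    · simp only [map_mul, map_adeleFiniteProj_adelicOfFamily, Pi.mulSingle_mul, Pi.mul_apply]

/-- The unitary character `χ` of `T(𝔸_k)` is automorphic: it is trivial on `T(k)`, so that it is a
character of `T(𝔸_k)/T(k)`. -/
def IsAutomorphic (χ : AdelicPoints k A →ₜ* Circle) : Prop :=
  ∀ γ : Points k A k, χ (globalToAdelic k A γ) = 1

/-- The character `χ` of `T(𝔸_k)` is unramified at the finite place `v`: it is trivial on the maximal
compact subgroup of `T(k_v)`. -/
def IsUnramifiedAt (χ : AdelicPoints k A →ₜ* Circle) (v : FinitePlaces k) : Prop :=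
  ∀ x ∈ maxCompactSubgroup (LocalPoints k A v), χ (localToAdelic v x) = 1

end NumberField

end TorusCharacters

end

open TorusCharacters

open scoped TensorProduct NumberField

noncomputable section

namespace TorusCharacters

open IsDedekindDomain NumberField WithConv

/-! ### Topology of groups of points -/

namespace Points

section

variable {k A R R' : Type*} [Field k] [CommRing A] [HopfAlgebra k A]
  [CommRing R] [Algebra k R] [CommRing R'] [Algebra k R']

/-! Over k̄ the torus T is split, so a point x is known through the values c(x) of the characters c
∈ ℤⁿ (`ext_charValue`), and the Galois group acts on ℤⁿ. At a finite place the maximal compact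
subgroup is the set of x with |c(x)| = 1 for all c (`maxCompactSubgroup_eq_unitPoints`). For a set U
of finite places, the adelic points lying in these subgroups outside U form an open subgroup H_U
(`isOpen_unitsOutside`). The circle is divisible, so a continuous unitary character of an open
subgroup which is trivial on the rational points in it extends to an automorphic character
(`exists_continuous_extension`).

The prescribed local character gives, by projection to the components at S or u₀, a character θ of
H_U, with U = ∅ in (1) and U = {u₀} in (2). No condition is imposed at infinity, so it is enough to
cancel θ on Γ_U = T(k) ∩ H_U by a continuous character of T(k_∞). Thus the heart of the matter is
that every abstract unitary character of Γ_U is the restriction of a continuous character of T(k_∞).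

For U = ∅, the basis characters take values in the units of a number field L on Γ_∅ and embed it in
(𝓞_Lˣ)ⁿ. The character extends there by divisibility, and Dirichlet's unit theorem interpolates each
character of 𝓞_Lˣ by an archimedean one (`exists_extension_units`): a power of z/|z| for the roots
of unity, the exponential of a linear form in the log|z| for the fundamental units.

For U = {u}, what remains is a character of Γ_u/Γ_∅, a group detected by the |c(γ)|_u. For a local
point x the map c ↦ log|c(x)|_u is invariant under the local Galois group and has a free image of
finite rank, so it defines a split subtorus of T over k_u. By hypothesis this lies in A_T, on whose
characters the global Galois group acts trivially; hence the map is invariant under the global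
Galois group (`absChar_galAct`). So N_{L/k}(c(γ)) is a unit outside u and determines |c(γ)|_u, and
the product formula makes ∏_τ |τ(c(γ))| a power q^m with m = 0 only if |c(γ)|_u = 1
(`exists_prod_norm_embeddings_eq_zpow`). These archimedean sizes are defined on all of T(k_∞), and
exponentials of linear forms in their logarithms interpolate the remaining character
(`exists_archimedean_extension_of_splitPartCompatible`). -/

theorem eval_mul_repr (x y : Points k A R) {a : A} {ι : Type*} (r : Coalgebra.Repr k a ι) :
    (x * y).eval a = ∑ i ∈ r.index, x.eval (r.left i) * y.eval (r.right i) := by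
  rw [eval_mul, ← r.eq, map_sum]
  exact Finset.sum_congr rfl fun i _ => Algebra.TensorProduct.lift_tmul ..

theorem continuous_eval [TopologicalSpace R] (a : A) :
    Continuous fun x : Points k A R => x.eval a :=
  (continuous_apply a).comp continuous_induced_dom

theorem continuous_iff [TopologicalSpace R] {X : Type*} [TopologicalSpace X]
    {f : X → Points k A R} : Continuous f ↔ ∀ a, Continuous fun x => (f x).eval a := by
  rw [continuous_induced_rng, continuous_pi_iff]
  rfl

instance [TopologicalSpace R] [IsTopologicalRing R] : ContinuousMul (Points k A R) where
  continuous_mul := by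
    rw [continuous_iff]
    intro a
    let r := Coalgebra.Repr.arbitrary k a
    simp only [eval_mul_repr _ _ r]
    exact continuous_finsetSum _ fun i _ =>
      ((continuous_eval _).comp continuous_fst).mul ((continuous_eval _).comp continuous_snd)

theorem continuous_map [TopologicalSpace R] [TopologicalSpace R'] (φ : R →ₐ[k] R')
    (hφ : Continuous φ) : Continuous (map φ : Points k A R → Points k A R') :=
  continuous_iff.2 fun a => hφ.comp (continuous_eval a)

theorem map_injective (φ : R →ₐ[k] R') (hφ : Function.Injective φ) :
    Function.Injective (map φ : Points k A R → Points k A R') := fun _ _ h =>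
  eval_injective <| funext fun a => hφ (congrArg (fun z => z.eval a) h)

theorem map_comp {R'' : Type*} [CommRing R''] [Algebra k R''] (ψ : R' →ₐ[k] R'') (φ : R →ₐ[k] R')
    (x : Points k A R) : map (ψ.comp φ) x = map ψ (map φ x) := rfl

end

end Points

/-! ### Characters of a torus -/

section Characters

variable {k A : Type*} [Field k] [CommRing A] [HopfAlgebra k A] {n : ℕ}

/-- The evaluation `k̄ ⊗ A → E` at a point of `T(E)`, for an embedding of `k̄` into `E`. -/
def geomEval {E : Type*} [CommRing E] [Algebra k E] (ι : AlgebraicClosure k →ₐ[k] E)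
    (x : Points k A E) : AlgebraicClosure k ⊗[k] A →ₐ[k] E :=
  Algebra.TensorProduct.lift ι x.toAlgHom fun _ _ => .all ..

section

variable {E E' : Type*} [CommRing E] [Algebra k E] [CommRing E'] [Algebra k E']
  (ι : AlgebraicClosure k →ₐ[k] E)

@[simp]
theorem geomEval_tmul (x : Points k A E) (l : AlgebraicClosure k) (a : A) :
    geomEval ι x (l ⊗ₜ a) = ι l * x.eval a :=
  Algebra.TensorProduct.lift_tmul ..

theorem geomEval_map (φ : E →ₐ[k] E') (x : Points k A E) (z : AlgebraicClosure k ⊗[k] A) :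
    geomEval (φ.comp ι) (Points.map φ x) z = φ (geomEval ι x z) := by
  induction z with
  | zero => simp
  | add y z hy hz => simp only [map_add, hy, hz]
  | tmul b c => simp [Points.eval_map]

theorem geomEval_one_tmul (x : Points k A E) (a : A) : geomEval ι x (1 ⊗ₜ a) = x.eval a := by
  simp

theorem continuous_geomEval [TopologicalSpace E] [IsTopologicalRing E]
    (z : AlgebraicClosure k ⊗[k] A) : Continuous fun x : Points k A E => geomEval ι x z := by
  induction z with
  | zero => simp only [map_zero]; exact continuous_const
  | add y z hy hz => simp only [map_add]; exact hy.add hz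
  | tmul l a =>
    simp only [geomEval_tmul]
    exact continuous_const.mul (Points.continuous_eval a)

theorem geomEval_comp_algEquiv (σ : AlgebraicClosure k →ₐ[k] AlgebraicClosure k)
    (x : Points k A E) (z : AlgebraicClosure k ⊗[k] A) :
    geomEval (ι.comp σ) x z =
      geomEval ι x (Algebra.TensorProduct.map σ (AlgHom.id k A) z) := by
  induction z with
  | zero => simp
  | add y z hy hz => simp only [map_add, hy, hz]
  | tmul b c => simp

/-- Evaluation at xy equals (ev x ⊗ ev y) ∘ Δ on all of k̄ ⊗ A: both are k̄-algebra maps, and on 1 ⊗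
a this is the definition of the product of points. For group-like g one has Δg = g ⊗ g. -/
theorem geomEval_mul_of_isGroupLike (x y : Points k A E) {g : AlgebraicClosure k ⊗[k] A}
    (hg : IsGroupLikeElem (AlgebraicClosure k) g) :
    geomEval ι (x * y) g = geomEval ι x g * geomEval ι y g := by
  let _ : Algebra (AlgebraicClosure k) E := ι.toRingHom.toAlgebra
  have : IsScalarTower k (AlgebraicClosure k) E :=
    .of_algebraMap_eq fun c => (ι.commutes c).symm
  let ev (z : Points k A E) : AlgebraicClosure k ⊗[k] A →ₐ[AlgebraicClosure k] E :=
    Algebra.TensorProduct.lift (Algebra.ofId _ E) z.toAlgHom fun _ _ => .all ..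
  have hev (z w) : ev z w = geomEval ι z w := by
    induction w with
    | zero => simp
    | add y z hy hz => simp only [map_add, hy, hz]
    | tmul b c => exact (Algebra.TensorProduct.lift_tmul ..).trans (geomEval_tmul ..).symm
  have key : ev (x * y) = (Algebra.TensorProduct.lift (ev x) (ev y) fun _ _ => .all ..).comp
      (Bialgebra.comulAlgHom (AlgebraicClosure k) (AlgebraicClosure k ⊗[k] A)) := by
    apply Algebra.TensorProduct.ext
    · ext
    · ext a
      let r := Coalgebra.Repr.arbitrary k a
      have h1 : ev (x * y) (1 ⊗ₜ a) = (x * y).eval a := by rw [hev, geomEval_one_tmul]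
      have h2 : Coalgebra.comul (R := AlgebraicClosure k)
          ((1 : AlgebraicClosure k) ⊗ₜ[k] a) =
          ∑ i ∈ r.index, ((1 : AlgebraicClosure k) ⊗ₜ[k] r.left i) ⊗ₜ[AlgebraicClosure k]
            ((1 : AlgebraicClosure k) ⊗ₜ[k] r.right i) := by
        rw [TensorProduct.comul_tmul, ← r.eq]
        simp [TensorProduct.tmul_sum]
      have h3 : (Algebra.TensorProduct.lift (ev x) (ev y) fun _ _ => .all ..)
          (Coalgebra.comul (R := AlgebraicClosure k) ((1 : AlgebraicClosure k) ⊗ₜ[k] a)) =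
          (x * y).eval a := by
        rw [h2, map_sum, Points.eval_mul_repr x y r]
        refine Finset.sum_congr rfl fun i _ => ?_
        rw [Algebra.TensorProduct.lift_tmul, hev, hev, geomEval_one_tmul, geomEval_one_tmul]
      exact h1.trans h3.symm
  have := congrArg (fun f => f g) key
  simp only [hev] at this
  rw [this]
  change (Algebra.TensorProduct.lift (ev x) (ev y) fun _ _ => .all ..) (Coalgebra.comul g) = _
  rw [hg.comul_eq_tmul_self, Algebra.TensorProduct.lift_tmul, hev, hev]

theorem geomEval_one_of_isGroupLike {g : AlgebraicClosure k ⊗[k] A}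
    (hg : IsGroupLikeElem (AlgebraicClosure k) g) :
    geomEval ι (1 : Points k A E) g = 1 := by
  have h : ∀ z : AlgebraicClosure k ⊗[k] A,
      geomEval ι (1 : Points k A E) z = ι (Coalgebra.counit z) := by
    intro z
    induction z with
    | zero => simp
    | add y z hy hz => simp only [map_add, hy, hz]
    | tmul b c => simp [Points.eval_one, Algebra.smul_def, mul_comm]
  rw [h, hg.counit_eq_one, map_one]

end

/-- The group-like element of `k̄ ⊗ A` attached to a character of the split torus. -/
def groupLike (e : AlgebraicClosure k ⊗[k] A ≃ₐc[AlgebraicClosure k]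
    SplitTorusRing (AlgebraicClosure k) n) (c : Fin n → ℤ) : AlgebraicClosure k ⊗[k] A :=
  e.symm (AddMonoidAlgebra.single c 1)

variable (e : AlgebraicClosure k ⊗[k] A ≃ₐc[AlgebraicClosure k]
    SplitTorusRing (AlgebraicClosure k) n)

theorem apply_groupLike (c : Fin n → ℤ) : e (groupLike e c) = AddMonoidAlgebra.single c 1 :=
  e.apply_symm_apply _

theorem isGroupLikeElem_groupLike (c : Fin n → ℤ) :
    IsGroupLikeElem (AlgebraicClosure k) (groupLike e c) :=
  (AddMonoidAlgebra.isGroupLikeElem_of c).map e.symm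

theorem groupLike_zero : groupLike e 0 = 1 := map_one e.symm

theorem groupLike_add (c d : Fin n → ℤ) :
    groupLike e (c + d) = groupLike e c * groupLike e d := by
  simp only [groupLike, ← map_mul, AddMonoidAlgebra.single_mul_single, one_mul]

theorem eq_sum_groupLike (z : AlgebraicClosure k ⊗[k] A) :
    z = (e z).coeff.sum fun c l => l • groupLike e c := by
  apply EquivLike.injective e
  conv_lhs => rw [← AddMonoidAlgebra.sum_coeff_single (e z)]
  simp only [Finsupp.sum, map_sum, map_smul, apply_groupLike]
  simp

/-- The value at a point of `T(E)` of the character `c` of `T`. -/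
def charValue {E : Type*} [CommRing E] [Algebra k E] (ι : AlgebraicClosure k →ₐ[k] E)
    (x : Points k A E) (c : Fin n → ℤ) : E :=
  geomEval ι x (groupLike e c)

section

variable {E E' : Type*} [CommRing E] [Algebra k E] [CommRing E'] [Algebra k E']
  (ι : AlgebraicClosure k →ₐ[k] E)

theorem charValue_mul (x y : Points k A E) (c : Fin n → ℤ) :
    charValue e ι (x * y) c = charValue e ι x c * charValue e ι y c :=
  geomEval_mul_of_isGroupLike ι x y (isGroupLikeElem_groupLike e c)

theorem charValue_one (c : Fin n → ℤ) : charValue e ι (1 : Points k A E) c = 1 :=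
  geomEval_one_of_isGroupLike ι (isGroupLikeElem_groupLike e c)

theorem charValue_zero (x : Points k A E) : charValue e ι x 0 = 1 := by
  rw [charValue, groupLike_zero, map_one]

theorem charValue_add (x : Points k A E) (c d : Fin n → ℤ) :
    charValue e ι x (c + d) = charValue e ι x c * charValue e ι x d := by
  rw [charValue, groupLike_add, map_mul]; rfl

theorem charValue_map (φ : E →ₐ[k] E') (x : Points k A E) (c : Fin n → ℤ) :
    charValue e (φ.comp ι) (Points.map φ x) c = φ (charValue e ι x c) :=
  geomEval_map ι φ x _

/-- The group-like elements span k̄ ⊗ A, and the coefficients do not depend on x. Hence character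
values separate points, and bounds on them bound every coordinate. -/
theorem geomEval_eq_sum_charValue (x : Points k A E) (z : AlgebraicClosure k ⊗[k] A) :
    geomEval ι x z = (e z).coeff.sum fun c l => ι l * charValue e ι x c := by
  conv_lhs => rw [eq_sum_groupLike e z]
  simp only [Finsupp.sum, map_sum]
  refine Finset.sum_congr rfl fun c _ => ?_
  rw [Algebra.smul_def, map_mul]
  congr 1
  exact (geomEval_tmul ι x _ 1).trans (by simp [Points.eval])

theorem eval_eq_sum_charValue (x : Points k A E) (a : A) :
    x.eval a = (e (1 ⊗ₜ a)).coeff.sum fun c l => ι l * charValue e ι x c := by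
  rw [← geomEval_one_tmul ι, geomEval_eq_sum_charValue]

theorem ext_charValue {x y : Points k A E}
    (h : ∀ c, charValue e ι x c = charValue e ι y c) : x = y :=
  Points.eval_injective <| funext fun a => by
    rw [eval_eq_sum_charValue e ι, eval_eq_sum_charValue e ι]
    simp only [h]

end

end Characters

/-! ### The Galois action on the character lattice -/

section Galois

variable {k A : Type*} [Field k] [CommRing A] [HopfAlgebra k A] {n : ℕ}
  (e : AlgebraicClosure k ⊗[k] A ≃ₐc[AlgebraicClosure k]
    SplitTorusRing (AlgebraicClosure k) n)

include e in
/-- The group of points of a torus is commutative. -/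
theorem points_mul_comm {R : Type*} [CommRing R] [Algebra k R] (x y : Points k A R) :
    x * y = y * x := by
  -- `R` embeds in k̄ ⊗ R, over which the characters are available and separate points.
  let j : R →ₐ[k] AlgebraicClosure k ⊗[k] R := Algebra.TensorProduct.includeRight
  have hj : Function.Injective j :=
    Algebra.TensorProduct.includeRight_injective (FaithfulSMul.algebraMap_injective k _)
  apply Points.map_injective j hj
  refine ext_charValue e Algebra.TensorProduct.includeLeft fun c => ?_
  simp only [map_mul, charValue_mul, mul_comm]

theorem groupLike_injective : Function.Injective (groupLike e) := fun c d h => by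
  have := congrArg e h
  simp only [apply_groupLike] at this
  exact AddMonoidAlgebra.single_left_injective one_ne_zero this

theorem exists_groupLike_eq {g : AlgebraicClosure k ⊗[k] A}
    (hg : IsGroupLikeElem (AlgebraicClosure k) g) : ∃ c, groupLike e c = g := by
  obtain ⟨c, hc⟩ := AddMonoidAlgebra.isGroupLikeElem_iff_mem_range_of.1 (hg.map e)
  refine ⟨c.toAdd, EquivLike.injective e ?_⟩
  rw [apply_groupLike, ← hc]
  rfl

/-- The action of the Galois group on the coefficients of `k̄ ⊗ A`. -/
def galTensor (A : Type*) [CommRing A] [HopfAlgebra k A]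
    (σ : AlgebraicClosure k ≃ₐ[k] AlgebraicClosure k) :
    AlgebraicClosure k ⊗[k] A →ₐ[k] AlgebraicClosure k ⊗[k] A :=
  Algebra.TensorProduct.map (σ : AlgebraicClosure k →ₐ[k] AlgebraicClosure k) (AlgHom.id k A)

theorem isGroupLikeElem_galTensor (σ : AlgebraicClosure k ≃ₐ[k] AlgebraicClosure k)
    {g : AlgebraicClosure k ⊗[k] A} (hg : IsGroupLikeElem (AlgebraicClosure k) g) :
    IsGroupLikeElem (AlgebraicClosure k) (galTensor A σ g) := by
  have hcomp : (galTensor A σ).toRingHom.comp (algebraMap (AlgebraicClosure k) _) =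
      (algebraMap (AlgebraicClosure k) (AlgebraicClosure k ⊗[k] A)).comp
        (σ : AlgebraicClosure k →+* AlgebraicClosure k) := by
    ext l
    simp [galTensor]
  -- σ is only semilinear over k̄, so its action on the tensor square is this ring homomorphism; it
  -- commutes with Δ because Δ is defined over k.
  let D := Algebra.TensorProduct.mapRingHom (σ : AlgebraicClosure k →+* AlgebraicClosure k)
    (galTensor A σ).toRingHom (galTensor A σ).toRingHom hcomp hcomp
  have h1 : ∀ z : AlgebraicClosure k ⊗[k] A,
      Coalgebra.counit (R := AlgebraicClosure k) (galTensor A σ z) =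
        σ (Coalgebra.counit (R := AlgebraicClosure k) z) := by
    intro z
    induction z with
    | zero => simp
    | add y z hy hz => simp only [map_add, hy, hz]
    | tmul l a => simp [galTensor, Algebra.smul_def]
  have h2 : ∀ z : AlgebraicClosure k ⊗[k] A,
      Coalgebra.comul (R := AlgebraicClosure k) (galTensor A σ z) =
        D (Coalgebra.comul (R := AlgebraicClosure k) z) := by
    intro z
    induction z with
    | zero => simp
    | add y z hy hz => simp only [map_add, hy, hz]
    | tmul l a =>
      let r := Coalgebra.Repr.arbitrary k a
      have h (l : AlgebraicClosure k) : Coalgebra.comul (R := AlgebraicClosure k) (l ⊗ₜ[k] a) =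
          ∑ i ∈ r.index, ((1 : AlgebraicClosure k) ⊗ₜ[k] r.left i) ⊗ₜ[AlgebraicClosure k]
            (l ⊗ₜ[k] r.right i) := by
        rw [TensorProduct.comul_tmul, ← r.eq]
        simp [TensorProduct.tmul_sum]
      have hl : galTensor A σ (l ⊗ₜ a) = σ l ⊗ₜ a := by simp [galTensor]
      rw [hl, h, h, map_sum]
      refine Finset.sum_congr rfl fun i _ => ?_
      simp [D, galTensor]
  exact ⟨by rw [h1, hg.counit_eq_one, map_one],
    by rw [h2, hg.comul_eq_tmul_self]; simp [D]⟩

/-- The action of the Galois group on the characters of `T`. -/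
def galAct (σ : AlgebraicClosure k ≃ₐ[k] AlgebraicClosure k) (c : Fin n → ℤ) : Fin n → ℤ :=
  (exists_groupLike_eq e
    (isGroupLikeElem_galTensor σ (isGroupLikeElem_groupLike e c))).choose

theorem groupLike_galAct (σ : AlgebraicClosure k ≃ₐ[k] AlgebraicClosure k) (c : Fin n → ℤ) :
    groupLike e (galAct e σ c) = galTensor A σ (groupLike e c) :=
  (exists_groupLike_eq e
    (isGroupLikeElem_galTensor σ (isGroupLikeElem_groupLike e c))).choose_spec

/-- This trades a change of embedding for a change of character; all Galois equivariance of
character values comes from it. -/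
theorem charValue_comp_algEquiv {E : Type*} [CommRing E] [Algebra k E]
    (ι : AlgebraicClosure k →ₐ[k] E) (σ : AlgebraicClosure k ≃ₐ[k] AlgebraicClosure k)
    (x : Points k A E) (c : Fin n → ℤ) :
    charValue e (ι.comp (σ : AlgebraicClosure k →ₐ[k] AlgebraicClosure k)) x c =
      charValue e ι x (galAct e σ c) := by
  rw [charValue, geomEval_comp_algEquiv, charValue, groupLike_galAct]
  rfl

/-- The characters at a rational point are Galois equivariant. -/
theorem charValue_galAct (σ : AlgebraicClosure k ≃ₐ[k] AlgebraicClosure k)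
    (x : Points k A k) (c : Fin n → ℤ) :
    charValue e (AlgHom.id k _) (Points.map (Algebra.ofId k (AlgebraicClosure k)) x)
      (galAct e σ c) =
    σ (charValue e (AlgHom.id k _) (Points.map (Algebra.ofId k (AlgebraicClosure k)) x) c) := by
  rw [← charValue_comp_algEquiv]
  refine Eq.trans ?_ (charValue_map e (AlgHom.id k _)
    (σ : AlgebraicClosure k →ₐ[k] AlgebraicClosure k)
    (Points.map (Algebra.ofId k (AlgebraicClosure k)) x) c)
  rw [← Points.map_comp, AlgHom.id_comp, AlgHom.comp_id]
  congr 2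
  exact congrArg _ (Subsingleton.elim _ _)

/-! ### Restriction of characters to a split subtorus -/

section Quotient

variable {r : ℕ} (π : A →ₐc[k] SplitTorusRing k r)

/-- The restriction of functions to a split subtorus, over the algebraic closure. -/
def geomRestrict : AlgebraicClosure k ⊗[k] A →ₐc[AlgebraicClosure k]
    AlgebraicClosure k ⊗[k] SplitTorusRing k r :=
  Bialgebra.TensorProduct.map (BialgHom.id (AlgebraicClosure k) (AlgebraicClosure k)) π

theorem galTensor_geomRestrict (σ : AlgebraicClosure k ≃ₐ[k] AlgebraicClosure k)
    (z : AlgebraicClosure k ⊗[k] A) :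
    galTensor (SplitTorusRing k r) σ (geomRestrict π z) = geomRestrict π (galTensor A σ z) := by
  induction z with
  | zero => simp
  | add y z hy hz => simp only [map_add, hy, hz]
  | tmul l a => simp [galTensor, geomRestrict]

/-- The monomials are group-like and already span over k̄, while distinct group-like elements are
linearly independent, so there is no room for another one. -/
theorem exists_one_tmul_single_eq {g : AlgebraicClosure k ⊗[k] SplitTorusRing k r}
    (hg : IsGroupLikeElem (AlgebraicClosure k) g) :
    ∃ m : Fin r → ℤ, g = 1 ⊗ₜ AddMonoidAlgebra.single m 1 := by
  let t : Set (AlgebraicClosure k ⊗[k] SplitTorusRing k r) :=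
    Set.range fun m : Fin r → ℤ => 1 ⊗ₜ AddMonoidAlgebra.single m 1
  have ht : t ⊆ {g | IsGroupLikeElem (AlgebraicClosure k) g} := by
    rintro _ ⟨m, rfl⟩
    have hm := AddMonoidAlgebra.isGroupLikeElem_of (R := k) (A := k) (m : Fin r → ℤ)
    have hm1 : Coalgebra.comul (R := k) (AddMonoidAlgebra.single m (1 : k)) =
      AddMonoidAlgebra.single m (1 : k) ⊗ₜ AddMonoidAlgebra.single m (1 : k) :=
        hm.comul_eq_tmul_self
    have hm2 : Coalgebra.counit (R := k) (AddMonoidAlgebra.single m (1 : k)) = 1 :=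
        hm.counit_eq_one
    exact ⟨by rw [TensorProduct.counit_tmul, hm2]; simp,
      by rw [TensorProduct.comul_tmul, hm1]; simp⟩
  have hspan (g) : g ∈ Submodule.span (AlgebraicClosure k) t := by
    induction g with
    | zero => exact zero_mem _
    | add y z hy hz => exact add_mem hy hz
    | tmul l a =>
      rw [← AddMonoidAlgebra.sum_coeff_single a, Finsupp.sum, TensorProduct.tmul_sum]
      refine sum_mem fun m _ => ?_
      have : l ⊗ₜ[k] AddMonoidAlgebra.single m (a.coeff m) = (a.coeff m • l) •
          ((1 : AlgebraicClosure k) ⊗ₜ[k] AddMonoidAlgebra.single m (1 : k)) := by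
        rw [TensorProduct.smul_tmul', smul_eq_mul, mul_one, TensorProduct.smul_tmul,
          AddMonoidAlgebra.smul_single, smul_eq_mul, mul_one]
      rw [this]
      exact Submodule.smul_mem _ _ (Submodule.subset_span ⟨m, rfl⟩)
  have hli := linearIndepOn_isGroupLikeElem (R := AlgebraicClosure k)
    (A := AlgebraicClosure k ⊗[k] SplitTorusRing k r)
  by_contra hcon
  have hgt : g ∉ t := fun ⟨m, hm⟩ => hcon ⟨m, hm.symm⟩
  have := (hli.mono (Set.insert_subset hg ht)).notMem_span_of_insert hgt
  rw [Set.image_id] at this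
  exact this (hspan g)

/-- The map `π` is defined over k, so restriction commutes with Galois, and the characters of a
split torus are themselves defined over k, hence fixed. -/
theorem geomRestrict_groupLike_galAct (σ : AlgebraicClosure k ≃ₐ[k] AlgebraicClosure k)
    (c : Fin n → ℤ) :
    geomRestrict π (groupLike e (galAct e σ c)) = geomRestrict π (groupLike e c) := by
  obtain ⟨m, hm⟩ := exists_one_tmul_single_eq
    ((isGroupLikeElem_groupLike e c).map (geomRestrict π))
  rw [groupLike_galAct, ← galTensor_geomRestrict, hm]
  simp [galTensor]

end Quotient

end Galois

/-! ### Tori over local fields -/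

section Local

variable {k A : Type*} [Field k] [CommRing A] [HopfAlgebra k A] {n : ℕ}
  (e : AlgebraicClosure k ⊗[k] A ≃ₐc[AlgebraicClosure k]
    SplitTorusRing (AlgebraicClosure k) n)
  {K : Type*} [NontriviallyNormedField K] [IsUltrametricDist K] [CompleteSpace K] [Algebra k K]

/-- The norm on the algebraic closure of a complete nonarchimedean field. -/
@[reducible]
def algClosureNormedField (K : Type*) [NontriviallyNormedField K] [IsUltrametricDist K]
    [CompleteSpace K] : NormedField (AlgebraicClosure K) :=
  spectralNorm.normedField K (AlgebraicClosure K)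

attribute [local instance] algClosureNormedField

instance (K : Type*) [NontriviallyNormedField K] [IsUltrametricDist K]
    [CompleteSpace K] : IsUltrametricDist (AlgebraicClosure K) :=
  IsUltrametricDist.isUltrametricDist_of_isNonarchimedean_norm
    (isNonarchimedean_spectralNorm (K := K) (L := AlgebraicClosure K))

theorem norm_algebraMap_algClosure (x : K) : ‖algebraMap K (AlgebraicClosure K) x‖ = ‖x‖ :=
  spectralNorm_extends x

theorem norm_algClosure_algEquiv (σ : AlgebraicClosure K ≃ₐ[K] AlgebraicClosure K)
    (x : AlgebraicClosure K) : ‖σ x‖ = ‖x‖ :=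
  (spectralNorm_eq_of_equiv σ x).symm

theorem continuous_algebraMap_algClosure : Continuous (algebraMap K (AlgebraicClosure K)) :=
  (AddMonoidHomClass.isometry_of_norm (algebraMap K (AlgebraicClosure K))
    norm_algebraMap_algClosure).continuous

variable (ι : AlgebraicClosure k →ₐ[k] AlgebraicClosure K)

/-- The absolute value of the character `c` at a local point. -/
def absChar (x : Points k A K) (c : Fin n → ℤ) : ℝ :=
  ‖charValue e ι (Points.map (IsScalarTower.toAlgHom k K (AlgebraicClosure K)) x) c‖

theorem absChar_mul (x y : Points k A K) (c : Fin n → ℤ) :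
    absChar e ι (x * y) c = absChar e ι x c * absChar e ι y c := by
  rw [absChar, map_mul, charValue_mul, norm_mul]; rfl

theorem absChar_one (c : Fin n → ℤ) : absChar e ι (1 : Points k A K) c = 1 := by
  rw [absChar, map_one, charValue_one, norm_one]

theorem absChar_pow (x : Points k A K) (c : Fin n → ℤ) (m : ℕ) :
    absChar e ι (x ^ m) c = absChar e ι x c ^ m := by
  induction m with
  | zero => rw [pow_zero, pow_zero, absChar_one]
  | succ m ih => rw [pow_succ, pow_succ, absChar_mul, ih]

theorem absChar_add (x : Points k A K) (c d : Fin n → ℤ) :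
    absChar e ι x (c + d) = absChar e ι x c * absChar e ι x d := by
  rw [absChar, charValue_add, norm_mul]; rfl

theorem absChar_zero (x : Points k A K) : absChar e ι x 0 = 1 := by
  rw [absChar, charValue_zero, norm_one]

theorem absChar_pos (x : Points k A K) (c : Fin n → ℤ) : 0 < absChar e ι x c := by
  refine lt_of_le_of_ne (norm_nonneg _) fun h => ?_
  have h1 := absChar_add e ι x c (-c)
  rw [add_neg_cancel, absChar_zero, ← h, zero_mul] at h1
  exact one_ne_zero h1

/-- The logarithm of the absolute value of characters at a local point. -/
def logChar (x : Points k A K) : (Fin n → ℤ) →+ ℝ where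
  toFun c := Real.log (absChar e ι x c)
  map_zero' := by rw [absChar_zero, Real.log_one]
  map_add' c d := by
    rw [absChar_add, Real.log_mul (absChar_pos e ι x c).ne' (absChar_pos e ι x d).ne']

theorem logChar_eq_zero_iff (x : Points k A K) (c : Fin n → ℤ) :
    logChar e ι x c = 0 ↔ absChar e ι x c = 1 :=
  ⟨fun h => Real.eq_one_of_pos_of_log_eq_zero (absChar_pos e ι x c) h,
    fun h => (congrArg Real.log h).trans Real.log_one⟩

theorem continuous_charValue (c : Fin n → ℤ) :
    Continuous fun x : Points k A K =>
      charValue e ι (Points.map (IsScalarTower.toAlgHom k K (AlgebraicClosure K)) x) c :=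
  (continuous_geomEval ι _).comp (Points.continuous_map _ continuous_algebraMap_algClosure)

theorem continuous_absChar (c : Fin n → ℤ) :
    Continuous fun x : Points k A K => absChar e ι x c :=
  (continuous_charValue e ι c).norm

/-- The subgroup of local points at which all characters are units. -/
def unitPoints : Subgroup (Points k A K) where
  carrier := {x | ∀ c, absChar e ι x c = 1}
  one_mem' := absChar_one e ι
  mul_mem' {x y} hx hy c := by rw [absChar_mul, hx, hy, one_mul]
  inv_mem' {x} hx c := by
    have := absChar_mul e ι x x⁻¹ c
    rwa [mul_inv_cancel, absChar_one, hx, one_mul, eq_comm] at this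

theorem mem_unitPoints {x : Points k A K} :
    x ∈ unitPoints e ι ↔ ∀ c, absChar e ι x c = 1 := Iff.rfl

theorem mem_unitPoints_iff_single {x : Points k A K} :
    x ∈ unitPoints e ι ↔ ∀ i, absChar e ι x (Pi.single i 1) = 1 := by
  refine ⟨fun h i => h _, fun h => ?_⟩
  have : logChar e ι x = 0 := by
    ext i
    exact (logChar_eq_zero_iff e ι x _).2 (h i)
  intro c
  rw [← logChar_eq_zero_iff, this]
  rfl

/-- A basis of characters suffices, and spheres of nonzero radius are open in an ultrametric field,
so finitely many open conditions cut out the subgroup. -/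
theorem isOpen_unitPoints : IsOpen (unitPoints e ι : Set (Points k A K)) := by
  have : (unitPoints e ι : Set (Points k A K)) = ⋂ i : Fin n,
      (fun x => charValue e ι (Points.map (IsScalarTower.toAlgHom k K (AlgebraicClosure K)) x)
        (Pi.single i 1)) ⁻¹' Metric.sphere 0 1 := by
    ext x
    simp only [SetLike.mem_coe, mem_unitPoints_iff_single, Set.mem_iInter, Set.mem_preimage,
      mem_sphere_zero_iff_norm]
    rfl
  rw [this]
  exact isOpen_iInter_of_finite fun i =>
    (IsUltrametricDist.isOpen_sphere 0 one_ne_zero).preimage (continuous_charValue e ι _)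

/-- If |c(x)| > 1, the powers of x have unbounded absolute value under c. Apply this to x and x⁻¹.
-/
theorem le_unitPoints_of_isCompact {H : Subgroup (Points k A K)}
    (hH : IsCompact (H : Set (Points k A K))) : H ≤ unitPoints e ι := by
  have key : ∀ c, ∀ x ∈ H, absChar e ι x c ≤ 1 := by
    intro c x hx
    obtain ⟨C, hC⟩ := (hH.image (continuous_absChar e ι c)).bddAbove
    by_contra! h
    obtain ⟨m, hm⟩ := pow_unbounded_of_one_lt C h
    have hpow := absChar_pow e ι x c m
    exact absurd (hC ⟨x ^ m, H.pow_mem hx m, rfl⟩) (not_le.2 (by simpa [hpow] using hm))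
  intro x hx c
  have h1 := absChar_mul e ι x x⁻¹ c
  rw [mul_inv_cancel, absChar_one] at h1
  have h2 := key c x⁻¹ (H.inv_mem hx)
  have h3 := key c x hx
  nlinarith [absChar_pos e ι x c, absChar_pos e ι x⁻¹ c]

theorem exists_norm_eval_le (a : A) :
    ∃ C, ∀ x ∈ unitPoints e ι, ‖Points.eval (x : Points k A K) a‖ ≤ C := by
  refine ⟨(e (1 ⊗ₜ a)).coeff.sum fun c l => ‖ι l‖, fun x hx => ?_⟩
  rw [← norm_algebraMap_algClosure]
  have : algebraMap K (AlgebraicClosure K) (x.eval a) =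
      (Points.map (IsScalarTower.toAlgHom k K (AlgebraicClosure K)) x).eval a := rfl
  rw [this, eval_eq_sum_charValue e ι]
  refine (norm_sum_le _ _).trans (Finset.sum_le_sum fun c _ => ?_)
  rw [norm_mul]
  exact (congrArg _ (hx c)).trans (mul_one _) |>.le

omit [CompleteSpace K] in
theorem isClosed_range_eval :
    IsClosed (Set.range (Points.eval : Points k A K → A → K)) := by
  have : Set.range (Points.eval : Points k A K → A → K) =
      (⋂ a, ⋂ b, {f | f (a * b) = f a * f b}) ∩ (⋂ a, ⋂ b, {f | f (a + b) = f a + f b}) ∩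
      ⋂ c : k, {f | f (algebraMap k A c) = algebraMap k K c} := by
    ext f
    simp only [Set.mem_range, Set.mem_inter_iff, Set.mem_iInter, Set.mem_ofPred_eq]
    constructor
    · rintro ⟨x, rfl⟩
      exact ⟨⟨map_mul x.toAlgHom, map_add x.toAlgHom⟩, x.toAlgHom.commutes⟩
    · rintro ⟨⟨h1, h2⟩, h3⟩
      have h4 : f 1 = 1 := by simpa using h3 1
      have h5 : f 0 = 0 := by simpa using h3 0
      exact ⟨Points.ofAlgHom ⟨⟨⟨⟨f, h4⟩, h1⟩, h5, h2⟩, h3⟩, rfl⟩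
  rw [this]
  refine ((isClosed_iInter fun a => isClosed_iInter fun b => ?_).inter
    (isClosed_iInter fun a => isClosed_iInter fun b => ?_)).inter (isClosed_iInter fun c => ?_)
  · exact isClosed_eq (continuous_apply _) (by fun_prop)
  · exact isClosed_eq (continuous_apply _) (by fun_prop)
  · exact isClosed_eq (continuous_apply _) continuous_const

/-- The coordinates embed T(K) as a closed subset of the product K^A, and each of them is bounded on
`unitPoints`, so Tychonoff's theorem applies. -/
theorem isCompact_unitPoints [ProperSpace K] :
    IsCompact (unitPoints e ι : Set (Points k A K)) := by
  choose C hC using exists_norm_eval_le e ι (K := K)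
  have hemb : Topology.IsClosedEmbedding (Points.eval : Points k A K → A → K) :=
    ⟨⟨⟨rfl⟩, Points.eval_injective⟩, isClosed_range_eval⟩
  have h1 : IsCompact (Set.pi Set.univ fun a : A => Metric.closedBall (0 : K) (C a)) :=
    isCompact_univ_pi fun a => isCompact_closedBall 0 (C a)
  refine (hemb.isCompact_preimage h1).of_isClosed_subset ?_ fun x hx a _ => ?_
  · have : (unitPoints e ι : Set (Points k A K)) = ⋂ c, {x | absChar e ι x c = 1} := by
      ext x; simp [mem_unitPoints]
    rw [this]
    exact isClosed_iInter fun c => isClosed_eq (continuous_absChar e ι c) continuous_const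
  · simpa using hC a x hx

theorem maxCompactSubgroup_eq_unitPoints [ProperSpace K] :
    maxCompactSubgroup (Points k A K) = unitPoints e ι :=
  le_antisymm (sSup_le fun _ hH => le_unitPoints_of_isCompact e ι hH)
    (le_sSup (isCompact_unitPoints e ι))

theorem norm_geomEval_le_one {x : Points k A K} {J : Type*} (s : Finset J)
    (l : J → AlgebraicClosure k) (a : J → A) (hl : ∀ j ∈ s, ‖ι (l j)‖ ≤ 1)
    (ha : ∀ j ∈ s, ‖x.eval (a j)‖ ≤ 1) :
    ‖geomEval ι (Points.map (IsScalarTower.toAlgHom k K (AlgebraicClosure K)) x)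
      (∑ j ∈ s, l j ⊗ₜ a j)‖ ≤ 1 := by
  rw [map_sum]
  refine IsUltrametricDist.norm_sum_le_of_forall_le_of_nonneg zero_le_one fun j hj => ?_
  rw [geomEval_tmul, norm_mul, Points.eval_map]
  exact mul_le_one₀ (hl j hj) (norm_nonneg _) ((norm_algebraMap_algClosure _).trans_le (ha j hj))

end Local

/-! ### Completions of number fields -/

section Completion

variable {k : Type*} [Field k] [NumberField k]

theorem norm_algebraMap_integer_le_one (v : FinitePlaces k) (x : 𝓞 k) :
    ‖algebraMap k (v.adicCompletion k) x‖ ≤ 1 :=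
  FinitePlace.norm_le_one k v x

theorem norm_algebraMap_integer_eq_one_iff (v : FinitePlaces k) (x : 𝓞 k) :
    ‖algebraMap k (v.adicCompletion k) x‖ = 1 ↔ x ∉ v.asIdeal :=
  FinitePlace.norm_eq_one_iff_notMem k v x

instance (v : FinitePlaces k) : NontriviallyNormedField (v.adicCompletion k) where
  non_trivial := by
    obtain ⟨x, hx, hx0⟩ := Submodule.exists_mem_ne_zero_of_ne_bot v.ne_bot
    refine ⟨(FinitePlace.embedding v (algebraMap (𝓞 k) k x))⁻¹, ?_⟩
    rw [norm_inv]
    refine (one_lt_inv₀ (norm_pos_iff.2 ?_)).2 ((FinitePlace.norm_lt_one_iff_mem k v x).2 hx)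
    simpa using hx0

theorem mem_adicCompletionIntegers_iff_norm_le_one (v : FinitePlaces k)
    {x : v.adicCompletion k} : x ∈ v.adicCompletionIntegers k ↔ ‖x‖ ≤ 1 :=
  (HeightOneSpectrum.mem_adicCompletionIntegers (𝓞 k) k v).trans
    Valued.toNormedField.norm_le_one_iff.symm

theorem valuation_le_one_iff_norm_le_one (v : FinitePlaces k) {x : k} :
    v.valuation k x ≤ 1 ↔ ‖algebraMap k (v.adicCompletion k) x‖ ≤ 1 := by
  rw [← mem_adicCompletionIntegers_iff_norm_le_one, HeightOneSpectrum.mem_adicCompletionIntegers]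
  exact iff_of_eq (congrArg (· ≤ 1) (HeightOneSpectrum.valuedAdicCompletion_eq_valuation' v x).symm)

theorem norm_sub_le_max_adic (v : FinitePlaces k) (x y : v.adicCompletion k) :
    ‖x - y‖ ≤ max ‖x‖ ‖y‖ := by
  rw [sub_eq_add_neg, ← norm_neg y]
  exact IsUltrametricDist.norm_add_le_max x (-y)

theorem residue_eq_zero_of_norm_lt_one (v : FinitePlaces k)
    (x : Valued.integer (v.adicCompletion k)) (hx : ‖(x : v.adicCompletion k)‖ < 1) :
    IsLocalRing.residue (Valued.integer (v.adicCompletion k)) x = 0 := by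
  rw [IsLocalRing.residue_eq_zero_iff, IsLocalRing.mem_maximalIdeal, mem_nonunits_iff]
  intro h
  have := (HeightOneSpectrum.adicCompletionIntegers.isUnit_iff_valued_eq_one
    (v := v) (K := k) (a := x)).1 h
  exact (Valued.toNormedField.norm_lt_one_iff.1 hx).ne this

/-- By density of k in k_v and approximation of v-integral elements of k by elements of 𝓞 k, the
residue field is a quotient of the finite ring 𝓞 k / v. -/
instance (v : FinitePlaces k) : Finite (Valued.ResidueField (v.adicCompletion k)) := by
  let f : 𝓞 k →+* Valued.ResidueField (v.adicCompletion k) :=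
    (IsLocalRing.residue (Valued.integer (v.adicCompletion k))).comp
      (algebraMap (𝓞 k) (v.adicCompletionIntegers k))
  have hf0 : ∀ a ∈ v.asIdeal, f a = 0 := fun a ha =>
    residue_eq_zero_of_norm_lt_one v _ ((FinitePlace.norm_lt_one_iff_mem k v a).2 ha)
  have hf : Function.Surjective f := by
    intro y
    obtain ⟨x, rfl⟩ := IsLocalRing.residue_surjective y
    have hx : ‖(x : v.adicCompletion k)‖ ≤ 1 :=
      (mem_adicCompletionIntegers_iff_norm_le_one v).1 x.2
    obtain ⟨z, hz⟩ := (HeightOneSpectrum.denseRange_algebraMap k v).exists_dist_lt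
      (x : v.adicCompletion k) one_pos
    rw [dist_eq_norm] at hz
    have hz1 : ‖algebraMap k (v.adicCompletion k) z‖ ≤ 1 := by
      have := norm_sub_le_max_adic v (x : v.adicCompletion k)
        (x - algebraMap k (v.adicCompletion k) z)
      rw [sub_sub_cancel] at this
      exact this.trans (max_le hx hz.le)
    obtain ⟨a, ha⟩ := v.exists_valuation_sub_lt_of_integer
      ((valuation_le_one_iff_norm_le_one v).2 hz1) 1
    have ha1 : ‖algebraMap k (v.adicCompletion k) (algebraMap (𝓞 k) k a - z)‖ < 1 := by
      refine Valued.toNormedField.norm_lt_one_iff.2 ?_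
      refine lt_of_eq_of_lt (HeightOneSpectrum.valuedAdicCompletion_eq_valuation' v _) ?_
      simpa using ha
    let b : Valued.integer (v.adicCompletion k) := algebraMap (𝓞 k) (v.adicCompletionIntegers k) a
    refine ⟨a, ?_⟩
    rw [← sub_eq_zero]
    refine (map_sub (IsLocalRing.residue (Valued.integer (v.adicCompletion k)))
      (algebraMap (𝓞 k) (v.adicCompletionIntegers k) a) x).symm.trans ?_
    refine residue_eq_zero_of_norm_lt_one v (b - x) ?_
    have : ((b - x : Valued.integer (v.adicCompletion k)) : v.adicCompletion k) =
        algebraMap k (v.adicCompletion k) (algebraMap (𝓞 k) k a - z) -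
          (x - algebraMap k (v.adicCompletion k) z) := by
      rw [map_sub]
      change algebraMap k (v.adicCompletion k) (algebraMap (𝓞 k) k a) - x = _
      ring
    rw [this]
    exact (norm_sub_le_max_adic v _ _).trans_lt (max_lt ha1 hz)
  have : Finite (𝓞 k ⧸ v.asIdeal) := Ideal.finiteQuotientOfFreeOfNeBot _ v.ne_bot
  exact Finite.of_surjective (Ideal.Quotient.lift _ f hf0)
    (Ideal.Quotient.lift_surjective_of_surjective _ _ hf)

instance (v : FinitePlaces k) : ProperSpace (v.adicCompletion k) := by
  have h := Valued.integer.properSpace_iff_completeSpace_and_isDiscreteValuationRing_integer_and_finite_residueField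
    (K := v.adicCompletion k)
  exact h.2 ⟨inferInstance,
    inferInstanceAs (IsDiscreteValuationRing (v.adicCompletionIntegers k)), inferInstance⟩

end Completion

/-! ### Extension of characters -/

instance : DivisibleBy (Additive Circle) ℤ :=
  divisibleByOfSMulRightSurj _ _ fun {n} hn z => by
    refine ⟨Additive.ofMul (Circle.exp (Complex.arg z.toMul / n)), ?_⟩
    have hn' : (n : ℝ) ≠ 0 := Int.cast_ne_zero.2 hn
    change Additive.ofMul (Circle.exp (Complex.arg z.toMul / n) ^ n) = z
    rw [← Circle.exp_intCast_mul, mul_div_cancel₀ _ hn', Circle.exp_arg]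
    rfl

/-- The circle group is divisible, so characters of discrete groups extend. -/
theorem exists_circle_extension {G H : Type*} [Group G] [CommGroup H] (j : G →* H)
    (ψ : G →* Circle) (h : ∀ g, j g = 1 → ψ g = 1) :
    ∃ ψ' : H →* Circle, ∀ g, ψ' (j g) = ψ g := by
  let ψ₁ : j.range →* Circle := (QuotientGroup.lift j.ker ψ h).comp
    (QuotientGroup.quotientKerEquivRange j).symm.toMonoidHom
  have hψ₁ (g : G) : ψ₁ ⟨j g, g, rfl⟩ = ψ g := by
    have : (QuotientGroup.quotientKerEquivRange j).symm ⟨j g, g, rfl⟩ = QuotientGroup.mk g := by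
      rw [MulEquiv.symm_apply_eq]
      rfl
    simp only [ψ₁, MonoidHom.comp_apply]
    exact (congrArg _ this).trans rfl
  obtain ⟨F, hF⟩ := (Module.Baer.of_divisible (Additive Circle)).extension_property_addMonoidHom
    (MonoidHom.toAdditive j.range.subtype) (fun a b hab => Subtype.ext hab)
    (MonoidHom.toAdditive ψ₁)
  refine ⟨MonoidHom.toAdditive.symm F, fun g => ?_⟩
  rw [← hψ₁ g]
  exact DFunLike.congr_fun hF (Additive.ofMul ⟨j g, g, rfl⟩)

/-- A character of an open subgroup extends to the whole group, trivially on a given subgroup. -/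
theorem exists_continuous_extension {G Γ : Type*} [Group G] [TopologicalSpace G]
    [ContinuousMul G] (hcomm : ∀ x y : G, x * y = y * x) [Group Γ] (f : Γ →* G)
    (H : Subgroup G) (hH : IsOpen (H : Set G)) (η : H →* Circle) (hη : Continuous η)
    (hf : ∀ (γ : Γ) (h : f γ ∈ H), η ⟨f γ, h⟩ = 1) :
    ∃ χ : G →ₜ* Circle, (∀ γ, χ (f γ) = 1) ∧ ∀ h : H, χ h = η h := by
  let _ : CommGroup G := { (inferInstance : Group G) with mul_comm := hcomm }
  -- The kernel of `H` → `G` / f(Γ) is `H` ∩ f(Γ), where `η` is trivial by `hf`. Topology is ignored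
  -- here: continuity near 1 is inherited from the open subgroup `H` and then translated.
  obtain ⟨χ, hχ⟩ := exists_circle_extension ((QuotientGroup.mk' f.range).comp H.subtype) η (by
    rintro ⟨x, hx⟩ h1
    obtain ⟨γ, rfl⟩ := (QuotientGroup.eq_one_iff x).1 h1
    exact hf γ hx)
  have hres (h : H) : χ (QuotientGroup.mk' f.range h) = η h := hχ h
  have hcont : Continuous (χ.comp (QuotientGroup.mk' f.range)) := by
    rw [continuous_iff_continuousAt]
    intro x
    have h1 : ContinuousAt (fun y : G => χ (QuotientGroup.mk' f.range y)) 1 := by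
      refine (hH.isOpenEmbedding_subtypeVal.continuousAt_iff (x := (1 : H))
        (g := fun y : G => χ (QuotientGroup.mk' f.range y))).1 ?_
      exact (hη.congr fun h => (hres h).symm).continuousAt
    have h2 : ContinuousAt (fun y : G => x⁻¹ * y) x := (continuous_const_mul _).continuousAt
    have h3 : ContinuousAt (fun y : G => χ (QuotientGroup.mk' f.range (x⁻¹ * y))) x :=
      ContinuousAt.comp (f := fun y : G => x⁻¹ * y)
        (g := fun y : G => χ (QuotientGroup.mk' f.range y)) (by rwa [inv_mul_cancel]) h2
    refine (ContinuousAt.mul (continuousAt_const (y := χ (QuotientGroup.mk' f.range x))) h3).congr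
      (Filter.Eventually.of_forall fun y => ?_)
    change χ _ * χ _ = χ _
    rw [← map_mul, ← map_mul, mul_inv_cancel_left]
  refine ⟨⟨χ.comp (QuotientGroup.mk' f.range), hcont⟩, fun γ => ?_, hres⟩
  have : QuotientGroup.mk' f.range (f γ) = 1 := (QuotientGroup.eq_one_iff _).2 ⟨γ, rfl⟩
  exact (congrArg χ this).trans (map_one χ)

/-! ### Characters of the unit group -/

/-- The character `z ↦ z / |z|` of `ℂˣ`. -/
def unitsToCircle : ℂˣ →ₜ* Circle where
  toFun z := ⟨(z : ℂ) / ‖(z : ℂ)‖, by simp [Submonoid.unitSphere]⟩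
  map_one' := by ext; simp
  map_mul' z w := by
    ext
    simp only [Units.val_mul, norm_mul, Complex.ofReal_mul, mul_div_mul_comm]
    rfl
  continuous_toFun := by
    refine Continuous.subtype_mk (Units.continuous_val.div₀
      (Complex.continuous_ofReal.comp Units.continuous_val.norm) fun z => ?_) _
    simp

theorem coe_unitsToCircle (z : ℂˣ) : (unitsToCircle z : ℂ) = z / ‖(z : ℂ)‖ := rfl

variable {L : Type*} [Field L] [NumberField L]

/-- The image of a unit of a number field under a complex embedding. -/
def unitEmbed (τ : L →+* ℂ) : (𝓞 L)ˣ →* ℂˣ :=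
  Units.map (τ.comp (algebraMap (𝓞 L) L) : 𝓞 L →* ℂ)

/-- The roots of unity of L form a finite cyclic group which one complex embedding injects into the
circle, so every character of it is a power of this injection. On them z/|z| = z. -/
theorem exists_extension_torsion (ψ : (𝓞 L)ˣ →* Circle) :
    ∃ P : ((L →+* ℂ) → ℂˣ) →ₜ* Circle,
      ∀ u ∈ Units.torsion L, P (fun τ => unitEmbed τ u) = ψ u := by
  obtain ⟨τ⟩ := (inferInstance : Nonempty (L →+* ℂ))
  obtain ⟨g, hg⟩ := IsCyclic.exists_generator (α := Units.torsion L)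
  let t : Units.torsion L →* Circle :=
    (unitsToCircle.toMonoidHom.comp (unitEmbed τ)).comp (Units.torsion L).subtype
  have hnorm (x : Units.torsion L) : ‖(unitEmbed τ x : ℂ)‖ = 1 := by
    have h1 : IsOfFinOrder (x : (𝓞 L)ˣ) := x.2
    have h2 : IsOfFinOrder ((unitEmbed τ x : ℂˣ) : ℂ) :=
      (Units.coeHom ℂ).isOfFinOrder ((unitEmbed τ).isOfFinOrder h1)
    exact h2.norm_eq_one
  have ht : Function.Injective t := by
    intro x y hxy
    have h1 : (unitEmbed τ x : ℂ) / ‖(unitEmbed τ x : ℂ)‖ =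
        (unitEmbed τ y : ℂ) / ‖(unitEmbed τ y : ℂ)‖ := congrArg (Subtype.val) hxy
    rw [hnorm, hnorm, Complex.ofReal_one, div_one, div_one] at h1
    exact Subtype.ext (Units.ext (RingOfIntegers.ext (τ.injective h1)))
  have hprim : IsPrimitiveRoot ((t g : Circle) : ℂ) (orderOf g) :=
    (IsPrimitiveRoot.orderOf g).map_of_injective (f := Circle.coeHom.comp t)
      (Circle.coe_injective.comp ht)
  have : NeZero (orderOf g) := ⟨(orderOf_pos g).ne'⟩
  obtain ⟨m, -, hm⟩ := hprim.eq_pow_of_pow_eq_one (ξ := ((ψ g : Circle) : ℂ)) (by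
    rw [← Circle.coe_pow, ← map_pow, ← Subgroup.coe_pow, pow_orderOf_eq_one]
    simp)
  have hm' : t g ^ m = ψ g := Circle.ext (by rw [Circle.coe_pow, hm])
  refine ⟨(ContinuousMonoidHom.mk (powMonoidHom m) (continuous_pow m)).comp
    (unitsToCircle.comp (ContinuousMonoidHom.mk (Pi.evalMonoidHom _ τ)
      (continuous_apply τ))), fun u hu => ?_⟩
  obtain ⟨i, hi⟩ := hg ⟨u, hu⟩
  have hi' : g ^ i = ⟨u, hu⟩ := hi
  change t ⟨u, hu⟩ ^ m = ψ ((⟨u, hu⟩ : Units.torsion L) : (𝓞 L)ˣ)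
  rw [← hi', map_zpow, ← zpow_natCast, zpow_comm, zpow_natCast, hm', Subgroup.coe_zpow, map_zpow]

-- The logarithms of the fundamental units are an ℝ-basis of the logarithmic space, so a linear form
-- can be given any values on them. Its exponential kills the torsion, whose logarithms vanish.
open Units Units.dirichletUnitTheorem in
open scoped Classical in
theorem exists_extension_fundSystem (θ : Fin (Units.rank L) → Circle) :
    ∃ P : ((L →+* ℂ) → ℂˣ) →ₜ* Circle,
      (∀ i, P (fun τ => unitEmbed τ (Units.fundSystem L i)) = θ i) ∧
      ∀ u ∈ Units.torsion L, P (fun τ => unitEmbed τ u) = 1 := by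
  let B := (basisUnitLattice L).ofZLatticeBasis ℝ (unitLattice L)
  let f : logSpace L →ₗ[ℝ] ℝ := B.constr ℝ fun i => Complex.arg (θ i)
  let l (z : (L →+* ℂ) → ℂˣ) : logSpace L :=
    fun w => w.1.mult * Real.log ‖(z w.1.embedding : ℂ)‖
  have hl1 : l 1 = 0 := by ext w; simp [l]
  have hlm (z z' : (L →+* ℂ) → ℂˣ) : l (z * z') = l z + l z' := by
    ext w
    have h1 : ‖(z w.1.embedding : ℂ)‖ ≠ 0 := by simp
    have h2 : ‖(z' w.1.embedding : ℂ)‖ ≠ 0 := by simp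
    simp only [l, Pi.mul_apply, Units.val_mul, norm_mul, Real.log_mul h1 h2, Pi.add_apply, mul_add]
  have hlc : Continuous l := by
    refine continuous_pi fun w => continuous_const.mul (Continuous.log ?_ fun z => by simp)
    exact (Units.continuous_val.comp (continuous_apply w.1.embedding)).norm
  have hlu (u : (𝓞 L)ˣ) : l (fun τ => unitEmbed τ u) = logEmbedding L (Additive.ofMul u) := by
    ext w
    rw [logEmbedding_component, ← InfinitePlace.norm_embedding_eq]
    rfl
  let P : ((L →+* ℂ) → ℂˣ) →ₜ* Circle :=
    { toFun z := Circle.exp (f (l z))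
      map_one' := by rw [hl1, map_zero, Circle.exp_zero]
      map_mul' z z' := by rw [hlm, map_add, Circle.exp_add]
      continuous_toFun :=
        Circle.exp.continuous.comp (f.continuous_of_finiteDimensional.comp hlc) }
  have hP (u : (𝓞 L)ˣ) : P (fun τ => unitEmbed τ u) =
      Circle.exp (f (logEmbedding L (Additive.ofMul u))) := by
    rw [← hlu]; rfl
  refine ⟨P, fun i => ?_, fun u hu => ?_⟩
  · rw [hP, logEmbedding_fundSystem, ← (basisUnitLattice L).ofZLatticeBasis_apply ℝ,
      Module.Basis.constr_basis, Circle.exp_arg]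
  · rw [hP, logEmbedding_eq_zero_iff.2 hu, map_zero, Circle.exp_zero]

/-- Characters of the unit group are restrictions of characters of the group of archimedean
points. -/
theorem exists_extension_units (ψ : (𝓞 L)ˣ →* Circle) :
    ∃ P : ((L →+* ℂ) → ℂˣ) →ₜ* Circle, ∀ u, P (fun τ => unitEmbed τ u) = ψ u := by
  obtain ⟨P₁, h₁⟩ := exists_extension_torsion ψ
  let d : (𝓞 L)ˣ →* ((L →+* ℂ) → ℂˣ) := MonoidHom.pi unitEmbed
  obtain ⟨P₂, h₂, h₃⟩ := exists_extension_fundSystem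
    (fun i => ψ (Units.fundSystem L i) / P₁ (d (Units.fundSystem L i)))
  refine ⟨P₁ * P₂, fun u => ?_⟩
  have key : ((P₁ * P₂).toMonoidHom.comp d) = ψ := by
    have htop := Units.closure_fundSystem_sup_torsion_eq_top L
    rw [← Units.torsion L |>.closure_eq, ← Subgroup.closure_union] at htop
    refine MonoidHom.eq_of_eqOn_dense htop ?_
    rintro u (⟨i, rfl⟩ | hu)
    · exact (congrArg _ (h₂ i)).trans (mul_div_cancel _ _)
    · exact (congrArg₂ _ (h₁ u hu) (h₃ u hu)).trans (mul_one _)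
  exact DFunLike.congr_fun key u

section

attribute [local instance] algClosureNormedField

/-! ### Rational points -/

section Rational

variable {k A : Type*} [Field k] [CommRing A] [HopfAlgebra k A] {n : ℕ}
  (e : AlgebraicClosure k ⊗[k] A ≃ₐc[AlgebraicClosure k]
    SplitTorusRing (AlgebraicClosure k) n)

/-- The value of a character at a rational point. -/
def ratChar (γ : Points k A k) (c : Fin n → ℤ) : AlgebraicClosure k :=
  charValue e (AlgHom.id k _) (Points.map (Algebra.ofId k (AlgebraicClosure k)) γ) c

theorem ratChar_mul (γ δ : Points k A k) (c : Fin n → ℤ) :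
    ratChar e (γ * δ) c = ratChar e γ c * ratChar e δ c := by
  rw [ratChar, map_mul, charValue_mul]; rfl

theorem ratChar_one (c : Fin n → ℤ) : ratChar e (1 : Points k A k) c = 1 := by
  rw [ratChar, map_one, charValue_one]

theorem ratChar_zero (γ : Points k A k) : ratChar e γ 0 = 1 := charValue_zero ..

theorem ratChar_add (γ : Points k A k) (c d : Fin n → ℤ) :
    ratChar e γ (c + d) = ratChar e γ c * ratChar e γ d := charValue_add ..

theorem ratChar_galAct (σ : AlgebraicClosure k ≃ₐ[k] AlgebraicClosure k) (γ : Points k A k)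
    (c : Fin n → ℤ) : ratChar e γ (galAct e σ c) = σ (ratChar e γ c) :=
  charValue_galAct e σ γ c

theorem charValue_map_ofId {E : Type*} [CommRing E] [Algebra k E]
    (ι : AlgebraicClosure k →ₐ[k] E) (γ : Points k A k) (c : Fin n → ℤ) :
    charValue e ι (Points.map (Algebra.ofId k E) γ) c = ι (ratChar e γ c) := by
  refine Eq.trans ?_ (charValue_map e (AlgHom.id k _) ι
    (Points.map (Algebra.ofId k (AlgebraicClosure k)) γ) c)
  rw [← Points.map_comp, AlgHom.comp_id]
  congr 2
  exact congrArg _ (Subsingleton.elim _ _)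

theorem eq_one_of_ratChar (γ : Points k A k) (h : ∀ i, ratChar e γ (Pi.single i 1) = 1) :
    γ = 1 := by
  apply Points.map_injective (Algebra.ofId k (AlgebraicClosure k))
    (algebraMap k (AlgebraicClosure k)).injective
  rw [map_one]
  refine ext_charValue e (AlgHom.id k _) fun c => ?_
  rw [charValue_one]
  let f : (Fin n → ℤ) →+ Additive (AlgebraicClosure k)ˣ :=
    MonoidHom.toAdditiveRight (MonoidHom.toHomUnits
      { toFun := fun c => ratChar e γ c.toAdd
        map_one' := ratChar_zero e γ
        map_mul' := fun c d => ratChar_add e γ c.toAdd d.toAdd })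
  have hf : f = 0 := by
    refine AddMonoidHom.functions_ext' _ _ _ fun i => AddMonoidHom.ext_int ?_
    exact congrArg Additive.ofMul (Units.ext (h i))
  exact congrArg (fun u : Additive (AlgebraicClosure k)ˣ => (u.toMul : AlgebraicClosure k))
    (DFunLike.congr_fun hf c)

theorem absChar_map_ofId {K : Type*} [NontriviallyNormedField K] [IsUltrametricDist K]
    [CompleteSpace K] [Algebra k K] (ι : AlgebraicClosure k →ₐ[k] AlgebraicClosure K)
    (γ : Points k A k) (c : Fin n → ℤ) :
    absChar e ι (Points.map (Algebra.ofId k K) γ) c = ‖ι (ratChar e γ c)‖ := by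
  rw [absChar, ← charValue_map_ofId, ← Points.map_comp]
  congr 3

end Rational

/-! ### Integrality of algebraic numbers -/

section Integral

variable {k : Type*} [Field k] [NumberField k]

/-- An embedding of the algebraic closure of `k` into that of the completion of `k` at `v`. -/
def placeEmbedding (v : FinitePlaces k) :
    AlgebraicClosure k →ₐ[k] AlgebraicClosure (v.adicCompletion k) :=
  IsAlgClosed.lift

theorem norm_placeEmbedding_algebraMap (v : FinitePlaces k) (x : k) :
    ‖placeEmbedding v (algebraMap k _ x)‖ = ‖algebraMap k (v.adicCompletion k) x‖ := by
  rw [AlgHom.commutes, IsScalarTower.algebraMap_apply k (v.adicCompletion k),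
    norm_algebraMap_algClosure]

theorem norm_placeEmbedding_integer_le_one (v : FinitePlaces k) (a : 𝓞 k) :
    ‖placeEmbedding v (algebraMap (𝓞 k) _ a)‖ ≤ 1 := by
  rw [IsScalarTower.algebraMap_apply (𝓞 k) k, norm_placeEmbedding_algebraMap]
  exact norm_algebraMap_integer_le_one v a

/-- The coefficients are, up to sign, elementary symmetric functions of the roots, with integer
coefficients. -/
theorem norm_coeff_prod_X_sub_C_le_one {F : Type*} [NormedField F] [IsUltrametricDist F]
    (s : Multiset F) (hs : ∀ r ∈ s, ‖r‖ ≤ 1) (i : ℕ) :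
    ‖(s.map fun r => Polynomial.X - Polynomial.C r).prod.coeff i‖ ≤ 1 := by
  induction s using Multiset.induction generalizing i with
  | empty =>
    rw [Multiset.map_zero, Multiset.prod_zero, Polynomial.coeff_one]
    split_ifs <;> simp
  | cons r s ih =>
    have ih' := ih fun r hr => hs r (Multiset.mem_cons_of_mem hr)
    have h1 (j : ℕ) : ‖-(r * (s.map fun r => Polynomial.X - Polynomial.C r).prod.coeff j)‖ ≤ 1 := by
      rw [norm_neg, norm_mul]
      exact mul_le_one₀ (hs r (Multiset.mem_cons_self r s)) (norm_nonneg _) (ih' j)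
    rw [Multiset.map_cons, Multiset.prod_cons, sub_mul, Polynomial.coeff_sub,
      Polynomial.coeff_C_mul]
    cases i with
    | zero => rw [Polynomial.coeff_X_mul_zero, zero_sub]; exact h1 0
    | succ i =>
      rw [Polynomial.coeff_X_mul, sub_eq_add_neg]
      exact (IsUltrametricDist.norm_add_le_max _ _).trans (max_le (ih' i) (h1 _))

/-- If ‖x‖ > 1, the leading term of a monic equation would strictly dominate all the others. -/
theorem norm_le_one_of_isIntegral {F O : Type*} [NormedField F] [IsUltrametricDist F]
    [CommRing O] (f : O →+* F) (hf : ∀ a, ‖f a‖ ≤ 1) {x : F} (hx : f.IsIntegralElem x) :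
    ‖x‖ ≤ 1 := by
  obtain ⟨p, hp, h0⟩ := hx
  by_contra! h
  rw [Polynomial.eval₂_eq_sum_range, Finset.sum_range_succ, hp.coeff_natDegree, map_one, one_mul,
    add_eq_zero_iff_neg_eq] at h0
  have hxpos : 0 < ‖x‖ := one_pos.trans h
  -- In degree 0 the equation reads 1 = 0; afterwards `natDegree - 1` is a true predecessor.
  rcases Nat.eq_zero_or_pos p.natDegree with hd | hd
  · rw [hd] at h0
    simp at h0
  have h1 : ‖∑ i ∈ Finset.range p.natDegree, f (p.coeff i) * x ^ i‖ ≤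
      ‖x‖ ^ (p.natDegree - 1) := by
    refine IsUltrametricDist.norm_sum_le_of_forall_le_of_nonneg (by positivity) fun i hi => ?_
    rw [norm_mul, norm_pow]
    refine (mul_le_of_le_one_left (by positivity) (hf _)).trans ?_
    exact pow_le_pow_right₀ h.le (Nat.le_sub_one_of_lt (Finset.mem_range.1 hi))
  rw [← norm_neg, h0, norm_pow] at h1
  exact absurd (pow_lt_pow_right₀ h (Nat.sub_one_lt_of_lt hd)) (not_lt.2 h1)

theorem finite_setOf_mem_asIdeal {d : 𝓞 k} (hd : d ≠ 0) :
    {v : FinitePlaces k | d ∈ v.asIdeal}.Finite := by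
  have := Ideal.finite_factors (R := 𝓞 k) (I := Ideal.span {d}) (by simpa using hd)
  refine this.subset fun v hv => ?_
  simpa [Ideal.dvd_span_singleton] using hv

/-- Some nonzero d in 𝓞 k makes dx integral, so only the finitely many places dividing d can be
exceptional. -/
theorem finite_setOf_one_lt_norm (x : AlgebraicClosure k) :
    {v : FinitePlaces k | 1 < ‖placeEmbedding v x‖}.Finite := by
  have halg : IsAlgebraic (𝓞 k) x := by
    have := IsLocalization.isAlgebraic k (nonZeroDivisors (𝓞 k))
    have : Algebra.IsAlgebraic (𝓞 k) (AlgebraicClosure k) :=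
      Algebra.IsAlgebraic.trans (𝓞 k) k (AlgebraicClosure k)
    exact Algebra.IsAlgebraic.isAlgebraic x
  obtain ⟨d, hd, hint⟩ := halg.exists_integral_multiple
  refine (finite_setOf_mem_asIdeal hd).subset fun v hv => ?_
  by_contra hdv
  refine not_le.2 (show 1 < ‖placeEmbedding v x‖ from hv) ?_
  have h1 : ‖placeEmbedding v (d • x)‖ ≤ 1 := by
    refine norm_le_one_of_isIntegral
      ((placeEmbedding v : AlgebraicClosure k →+* _).comp (algebraMap (𝓞 k) (AlgebraicClosure k)))
      (fun a => ?_) ?_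
    · exact norm_placeEmbedding_integer_le_one v a
    · obtain ⟨p, hp, h0⟩ := hint
      refine ⟨p, hp, ?_⟩
      have := congrArg (placeEmbedding v).toRingHom h0
      rw [Polynomial.hom_eval₂, map_zero] at this
      exact this
  have h2 : d • x = algebraMap k (AlgebraicClosure k) d * x := by
    exact Algebra.smul_def d x
  rwa [h2, map_mul, norm_mul,
    norm_placeEmbedding_algebraMap, (norm_algebraMap_integer_eq_one_iff v d).2 hdv, one_mul] at h1

/-- The bounds on all conjugates bound the coefficients of the minimal polynomial at every finite
place, so these coefficients lie in 𝓞 k. -/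
theorem isIntegral_of_norm_le_one {x : AlgebraicClosure k}
    (hx : ∀ (v : FinitePlaces k) (σ : AlgebraicClosure k ≃ₐ[k] AlgebraicClosure k),
      ‖placeEmbedding v (σ x)‖ ≤ 1) : IsIntegral (𝓞 k) x := by
  have hint : IsIntegral k x := Algebra.IsIntegral.isIntegral x
  have hcoeff (i : ℕ) : (minpoly k x).coeff i ∈ (algebraMap (𝓞 k) k).range := by
    refine HeightOneSpectrum.mem_integers_of_valuation_le_one k _ fun v => ?_
    rw [valuation_le_one_iff_norm_le_one, ← norm_placeEmbedding_algebraMap]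
    have h1 : (minpoly k x).map (algebraMap k (AlgebraicClosure k)) =
        (((minpoly k x).map (algebraMap k (AlgebraicClosure k))).roots.map
          fun r => Polynomial.X - Polynomial.C r).prod :=
      (IsAlgClosed.splits _).eq_prod_roots_of_monic ((minpoly.monic hint).map _)
    have h2 : ((minpoly k x).map (algebraMap k (AlgebraicClosure k))).map
        (placeEmbedding v : AlgebraicClosure k →+* _) =
        ((((minpoly k x).map (algebraMap k (AlgebraicClosure k))).roots.map (placeEmbedding v)).map
          fun r => Polynomial.X - Polynomial.C r).prod := by
      conv_lhs => rw [h1]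
      rw [Polynomial.map_multiset_prod, Multiset.map_map, Multiset.map_map]
      simp
    have h3 : placeEmbedding v (algebraMap k _ ((minpoly k x).coeff i)) =
        (((minpoly k x).map (algebraMap k (AlgebraicClosure k))).map
          (placeEmbedding v : AlgebraicClosure k →+* _)).coeff i := by
      rw [Polynomial.coeff_map, Polynomial.coeff_map]
      rfl
    rw [h3, h2]
    refine norm_coeff_prod_X_sub_C_le_one _ (fun r hr => ?_) i
    obtain ⟨y, hy, rfl⟩ := Multiset.mem_map.1 hr
    obtain ⟨σ, rfl⟩ := minpoly.exists_algEquiv_of_root' hint.isAlgebraic (by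
      rw [Polynomial.mem_roots', Polynomial.IsRoot, Polynomial.eval_map_algebraMap] at hy
      exact hy.2)
    exact hx v σ
  have hl : minpoly k x ∈ Polynomial.lifts (algebraMap (𝓞 k) k) :=
    (Polynomial.lifts_iff_coeff_lifts _).2 hcoeff
  obtain ⟨q, hq, -, hqm⟩ := Polynomial.lifts_and_natDegree_eq_and_monic hl (minpoly.monic hint)
  refine ⟨q, hqm, ?_⟩
  have h0 := minpoly.aeval k x
  rwa [← hq, Polynomial.aeval_map_algebraMap] at h0

end Integral

end

section

attribute [local instance] algClosureNormedField

/-! ### Adelic points -/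

section Adelic

variable {k A : Type*} [Field k] [NumberField k] [CommRing A] [HopfAlgebra k A] {n : ℕ}

theorem continuous_adeleFiniteProj (v : FinitePlaces k) : Continuous (adeleFiniteProj (k := k) v) :=
  (RestrictedProduct.continuous_eval v).comp continuous_snd

theorem continuous_adeleInfiniteProj : Continuous (adeleInfiniteProj (k := k)) :=
  continuous_fst

theorem map_adeleFiniteProj_globalToAdelic (v : FinitePlaces k) (γ : Points k A k) :
    Points.map (adeleFiniteProj v) (globalToAdelic k A γ) =
      Points.map (Algebra.ofId k (v.adicCompletion k)) γ := rfl

/-- The adelic points whose components lie in the maximal compact subgroups at all finite places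
outside `U`. -/
def unitsOutside (A : Type*) [CommRing A] [HopfAlgebra k A] (U : Set (FinitePlaces k)) :
    Subgroup (AdelicPoints k A) :=
  ⨅ v : (Uᶜ : Set (FinitePlaces k)),
    (maxCompactSubgroup (LocalPoints k A v.1)).comap (Points.map (adeleFiniteProj v.1))

theorem mem_unitsOutside {U : Set (FinitePlaces k)} {x : AdelicPoints k A} :
    x ∈ unitsOutside A U ↔ ∀ v ∉ U, Points.map (adeleFiniteProj v) x ∈
      maxCompactSubgroup (LocalPoints k A v) := by
  simp [unitsOutside, Subgroup.mem_iInf]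

variable (e : AlgebraicClosure k ⊗[k] A ≃ₐc[AlgebraicClosure k]
    SplitTorusRing (AlgebraicClosure k) n)

theorem mem_maxCompactSubgroup_iff (v : FinitePlaces k) (x : LocalPoints k A v) :
    x ∈ maxCompactSubgroup (LocalPoints k A v) ↔ ∀ c, absChar e (placeEmbedding v) x c = 1 := by
  rw [maxCompactSubgroup_eq_unitPoints e (placeEmbedding v), mem_unitPoints]

include e in
theorem isOpen_maxCompactSubgroup (v : FinitePlaces k) :
    IsOpen (maxCompactSubgroup (LocalPoints k A v) : Set (LocalPoints k A v)) := by
  rw [maxCompactSubgroup_eq_unitPoints e (placeEmbedding v)]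
  exact isOpen_unitPoints e _

include e in
theorem isCompact_maxCompactSubgroup (v : FinitePlaces k) :
    IsCompact (maxCompactSubgroup (LocalPoints k A v) : Set (LocalPoints k A v)) := by
  rw [maxCompactSubgroup_eq_unitPoints e (placeEmbedding v)]
  exact isCompact_unitPoints e _

/-- Away from finitely many places, a point with integral coordinates is in the maximal compact
subgroup. -/
theorem exists_integral_coordinates (c : Fin n → ℤ) : ∃ (s : Finset A) (S : Set (FinitePlaces k)),
    S.Finite ∧ ∀ v ∉ S, ∀ x : LocalPoints k A v, (∀ a ∈ s,
      ‖x.eval a - algebraMap k _ (Coalgebra.counit (R := k) a)‖ ≤ 1) →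
      absChar e (placeEmbedding v) x c ≤ 1 := by
  classical
  obtain ⟨t, ht⟩ := TensorProduct.exists_finset (R := k) (groupLike e c)
  refine ⟨t.image Prod.snd, (⋃ p ∈ t, {v | 1 < ‖placeEmbedding v p.1‖}) ∪
    ⋃ p ∈ t, {v | 1 < ‖placeEmbedding v
      (algebraMap k _ (Coalgebra.counit (R := k) p.2))‖}, ?_, ?_⟩
  · exact (t.finite_toSet.biUnion fun p _ => finite_setOf_one_lt_norm _).union
      (t.finite_toSet.biUnion fun p _ => finite_setOf_one_lt_norm _)
  intro v hv x hx
  simp only [Set.mem_union, Set.mem_iUnion, Set.mem_ofPred_eq, not_or, not_exists, not_lt] at hv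
  rw [absChar, charValue, ht]
  refine norm_geomEval_le_one _ t Prod.fst Prod.snd (fun p hp => hv.1 p hp) fun p hp => ?_
  have h1 := hv.2 p hp
  rw [norm_placeEmbedding_algebraMap] at h1
  have h2 := hx p.2 (Finset.mem_image_of_mem _ hp)
  rw [← sub_add_cancel (x.eval p.2) (algebraMap k _ (Coalgebra.counit (R := k) p.2))]
  exact (IsUltrametricDist.norm_add_le_max _ _).trans (max_le h2 h1)

/-- Subtracting the counit, which is the value at the identity, puts 1 in this set. Openness is that
of the integral adeles in the restricted product. -/
theorem isOpen_setOf_eval_integral (a : A) :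
    IsOpen {x : AdelicPoints k A | ∀ v : FinitePlaces k,
      ‖(Points.map (adeleFiniteProj v) x).eval a -
        algebraMap k _ (Coalgebra.counit (R := k) a)‖ ≤ 1} := by
  have h1 : IsOpen {f : FiniteAdeleRing (𝓞 k) k | ∀ v, f.1 v ∈ v.adicCompletionIntegers k} :=
    RestrictedProduct.isOpen_forall_mem fun v => Valued.isOpen_valuationSubring _
  have h0 : Continuous fun x : AdelicPoints k A =>
      x.eval a - algebraMap k (AdeleRing (𝓞 k) k) (Coalgebra.counit (R := k) a) :=
    (Points.continuous_eval a).sub continuous_const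
  have h2 : Continuous fun x : AdelicPoints k A =>
      (x.eval a - algebraMap k (AdeleRing (𝓞 k) k) (Coalgebra.counit (R := k) a)).2 :=
    continuous_snd.comp h0
  have h3 : {x : AdelicPoints k A | ∀ v : FinitePlaces k,
      ‖(Points.map (adeleFiniteProj v) x).eval a -
        algebraMap k _ (Coalgebra.counit (R := k) a)‖ ≤ 1} = (fun x : AdelicPoints k A =>
      (x.eval a - algebraMap k (AdeleRing (𝓞 k) k) (Coalgebra.counit (R := k) a)).2) ⁻¹'
        {f : FiniteAdeleRing (𝓞 k) k | ∀ v, f.1 v ∈ v.adicCompletionIntegers k} := by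
    ext x
    exact forall_congr' fun v => (mem_adicCompletionIntegers_iff_norm_le_one v).symm
  rw [h3]
  exact h1.preimage h2

include e in
theorem isOpen_unitsOutside (U : Set (FinitePlaces k)) :
    IsOpen (unitsOutside A U : Set (AdelicPoints k A)) := by
  choose s S hS hs using exists_integral_coordinates e
  -- The places where integral coordinates need not bound a basis character and its inverse. Only
  -- there is membership in the local subgroup imposed separately; both signs are needed because
  -- |c(x)| ≤ 1 and |c(x)|⁻¹ ≤ 1 together give equality.
  let T : Set (FinitePlaces k) := ⋃ i : Fin n, (S (Pi.single i 1) ∪ S (-Pi.single i 1))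
  have hT : T.Finite := Set.finite_iUnion fun i => (hS _).union (hS _)
  let W : Set (AdelicPoints k A) := (⋂ i : Fin n,
    ((⋂ a ∈ s (Pi.single i 1), {x : AdelicPoints k A | ∀ v : FinitePlaces k,
      ‖(Points.map (adeleFiniteProj v) x).eval a -
        algebraMap k _ (Coalgebra.counit (R := k) a)‖ ≤ 1}) ∩
    (⋂ a ∈ s (-Pi.single i 1), {x : AdelicPoints k A | ∀ v : FinitePlaces k,
      ‖(Points.map (adeleFiniteProj v) x).eval a -
        algebraMap k _ (Coalgebra.counit (R := k) a)‖ ≤ 1}))) ∩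
    ⋂ v ∈ T, Points.map (adeleFiniteProj v) ⁻¹' (maxCompactSubgroup (LocalPoints k A v))
  have hW : IsOpen W := by
    refine (isOpen_iInter_of_finite fun i => ?_).inter ?_
    · exact (isOpen_biInter_finset fun a _ => isOpen_setOf_eval_integral a).inter
        (isOpen_biInter_finset fun a _ => isOpen_setOf_eval_integral a)
    · exact hT.isOpen_biInter fun v _ => (isOpen_maxCompactSubgroup e v).preimage
        (Points.continuous_map _ (continuous_adeleFiniteProj v))
  have h1W : (1 : AdelicPoints k A) ∈ W := by
    simp only [W, Set.mem_inter_iff, Set.mem_iInter, Set.mem_ofPred_eq, map_one, Points.eval_one,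
      sub_self, norm_zero, zero_le_one, implies_true, and_self, Set.mem_preimage, true_and]
    exact fun v _ => one_mem _
  refine Subgroup.isOpen_of_mem_nhds _ (g := 1) (Filter.mem_of_superset (hW.mem_nhds h1W) ?_)
  intro x hx
  refine mem_unitsOutside.2 fun v _ => ?_
  by_cases hv : v ∈ T
  · exact Set.mem_iInter₂.1 hx.2 v hv
  have hx1 := Set.mem_iInter.1 hx.1
  rw [maxCompactSubgroup_eq_unitPoints e (placeEmbedding v), mem_unitPoints_iff_single]
  intro i
  simp only [T, Set.mem_iUnion, Set.mem_union, not_exists, not_or] at hv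
  have hp := hs (Pi.single i 1) v (hv i).1 (Points.map (adeleFiniteProj v) x)
    fun a ha => Set.mem_iInter₂.1 (hx1 i).1 a ha v
  have hm := hs (-Pi.single i 1) v (hv i).2 (Points.map (adeleFiniteProj v) x)
    fun a ha => Set.mem_iInter₂.1 (hx1 i).2 a ha v
  have h0 := absChar_add e (placeEmbedding v) (Points.map (adeleFiniteProj v) x)
    (Pi.single i 1) (-Pi.single i 1)
  rw [add_neg_cancel, absChar_zero] at h0
  nlinarith [absChar_pos e (placeEmbedding v) (Points.map (adeleFiniteProj v) x) (Pi.single i 1),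
    absChar_pos e (placeEmbedding v) (Points.map (adeleFiniteProj v) x) (-Pi.single i 1)]

/-! ### Semilocal points -/

include e in
theorem mem_maxCompactSubgroup_semilocal (S : Finset (FinitePlaces k))
    (x : SemilocalPoints k A S) : x ∈ maxCompactSubgroup (SemilocalPoints k A S) ↔
      ∀ v, x v ∈ maxCompactSubgroup (LocalPoints k A v.1) := by
  let B : Subgroup (SemilocalPoints k A S) :=
    Subgroup.pi Set.univ fun v => maxCompactSubgroup (LocalPoints k A v.1)
  have hB : maxCompactSubgroup (SemilocalPoints k A S) = B := by
    refine le_antisymm (sSup_le fun K hK => ?_) (le_sSup ?_)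
    · intro y hy v _
      have hc : IsCompact ((K.map (Pi.evalMonoidHom _ v) : Subgroup (LocalPoints k A v.1)) :
          Set (LocalPoints k A v.1)) := by
        rw [Subgroup.coe_map]
        exact IsCompact.image hK (continuous_apply v)
      exact le_sSup (a := K.map (Pi.evalMonoidHom _ v)) hc ⟨y, hy, rfl⟩
    · exact isCompact_univ_pi fun v => isCompact_maxCompactSubgroup e v.1
  rw [hB]
  simp [B, Subgroup.mem_pi]

include e in
theorem isCompact_maxCompactSubgroup_semilocal (S : Finset (FinitePlaces k)) :
    IsCompact (maxCompactSubgroup (SemilocalPoints k A S) : Set (SemilocalPoints k A S)) := by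
  have : (maxCompactSubgroup (SemilocalPoints k A S) : Set (SemilocalPoints k A S)) =
      Set.pi Set.univ fun v : S => (maxCompactSubgroup (LocalPoints k A v.1) :
        Set (LocalPoints k A v.1)) := by
    ext x
    simp [mem_maxCompactSubgroup_semilocal e]
  rw [this]
  exact isCompact_univ_pi fun v => isCompact_maxCompactSubgroup e v.1

/-- A character of a compact group is unitary. -/
theorem norm_eq_one_of_isCompact {G : Type*} [Group G] [TopologicalSpace G] {K : Subgroup G}
    (hK : IsCompact (K : Set G)) (χ : K →ₜ* ℂˣ) (x : K) : ‖(χ x : ℂ)‖ = 1 := by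
  have : CompactSpace K := isCompact_iff_compactSpace.1 hK
  obtain ⟨C, hC⟩ := (isCompact_range (Units.continuous_val.comp (map_continuous χ)).norm).bddAbove
  have key : ∀ y : K, ‖(χ y : ℂ)‖ ≤ 1 := by
    intro y
    by_contra! h
    obtain ⟨m, hm⟩ := pow_unbounded_of_one_lt C h
    refine absurd (hC ⟨y ^ m, rfl⟩) (not_le.2 ?_)
    simpa using hm
  have h1 := key x⁻¹
  rw [map_inv, Units.val_inv_eq_inv_val, norm_inv] at h1
  exact le_antisymm (key x) ((inv_le_one₀ (by simp)).1 h1)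

end Adelic

/-! ### Archimedean characters -/

section Archimedean

/-- A complex embedding of `k` extends continuously to the infinite adeles. -/
theorem exists_infiniteAdele_embedding {k : Type*} [Field k] (τ : k →+* ℂ) :
    ∃ ρ : InfiniteAdeleRing k →+* ℂ, Continuous ρ ∧ ∀ x, ρ (algebraMap k _ x) = τ x := by
  let v := InfinitePlace.mk τ
  let ρ₀ : InfiniteAdeleRing k →+* ℂ :=
    (InfinitePlace.Completion.extensionEmbedding v).comp (Pi.evalRingHom _ v)
  have hρ₀ : Continuous ρ₀ :=
    (InfinitePlace.Completion.isometry_extensionEmbedding v).continuous.comp (continuous_apply v)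
  have hx (x : k) : ρ₀ (algebraMap k _ x) = v.embedding x :=
    InfinitePlace.Completion.extensionEmbedding_coe v ((WithAbs.equiv v.1).symm x)
  -- A place determines a complex embedding only up to conjugation.
  rcases InfinitePlace.embedding_mk_eq τ with h | h
  · exact ⟨ρ₀, hρ₀, fun x => by rw [hx, h]⟩
  · refine ⟨(starRingEnd ℂ).comp ρ₀, Complex.continuous_conj.comp hρ₀, fun x => ?_⟩
    rw [RingHom.comp_apply, hx, h]
    simp [ComplexEmbedding.conjugate]

variable {k A : Type*} [Field k] [CommRing A] [HopfAlgebra k A] {n : ℕ}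
  (e : AlgebraicClosure k ⊗[k] A ≃ₐc[AlgebraicClosure k]
    SplitTorusRing (AlgebraicClosure k) n)

/-- A character of `T` and a complex embedding give a continuous character of the group of
archimedean points. -/
theorem exists_archimedean_character (τ : AlgebraicClosure k →+* ℂ) (c : Fin n → ℤ) :
    ∃ X : Points k A (InfiniteAdeleRing k) →ₜ* ℂˣ, ∀ γ : Points k A k,
      (X (Points.map (Algebra.ofId k _) γ) : ℂ) = τ (ratChar e γ c) := by
  let _ : Algebra k ℂ := (τ.comp (algebraMap k (AlgebraicClosure k))).toAlgebra
  let ι : AlgebraicClosure k →ₐ[k] ℂ := { τ with commutes' := fun _ => rfl }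
  obtain ⟨ρ₀, hρ₀, hx⟩ := exists_infiniteAdele_embedding
    (τ.comp (algebraMap k (AlgebraicClosure k)))
  let ρ : InfiniteAdeleRing k →ₐ[k] ℂ := { ρ₀ with commutes' := hx }
  let X₀ : Points k A (InfiniteAdeleRing k) →* ℂ :=
    { toFun x := charValue e ι (Points.map ρ x) c
      map_one' := by rw [map_one, charValue_one]
      map_mul' x y := by rw [map_mul, charValue_mul] }
  have hX₀ : Continuous X₀ := (continuous_geomEval ι _).comp (Points.continuous_map ρ hρ₀)
  refine ⟨⟨X₀.toHomUnits, Units.isEmbedding_val₀.continuous_iff.2 hX₀⟩, fun γ => ?_⟩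
  refine Eq.trans ?_ (charValue_map_ofId e ι γ c)
  change charValue e ι (Points.map ρ _) c = _
  rw [← Points.map_comp]
  congr 2
  exact congrArg _ (Subsingleton.elim _ _)

end Archimedean

end

section

attribute [local instance] algClosureNormedField

/-! ### Rational points and the first extension theorem -/

section FirstPart

variable {k A : Type*} [Field k] [NumberField k] [CommRing A] [HopfAlgebra k A] {n : ℕ}
  (e : AlgebraicClosure k ⊗[k] A ≃ₐc[AlgebraicClosure k]
    SplitTorusRing (AlgebraicClosure k) n)

omit [NumberField k] in
/-- The characters of a basis take values in a number field on the rational points. -/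
theorem exists_splittingField : ∃ L : IntermediateField k (AlgebraicClosure k),
    FiniteDimensional k L ∧ ∀ γ i, ratChar e γ (Pi.single i 1) ∈ L := by
  choose t ht using fun i : Fin n =>
    TensorProduct.exists_finset (R := k) (groupLike e (Pi.single i 1))
  -- The k̄-components of tensor expressions for the basis characters: finitely many, and chosen
  -- independently of the rational point.
  let B : Set (AlgebraicClosure k) := ⋃ i, Prod.fst '' (t i : Set (AlgebraicClosure k × A))
  have hB : B.Finite := Set.finite_iUnion fun i => (t i).finite_toSet.image _
  have : Finite B := hB
  refine ⟨IntermediateField.adjoin k B,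
    IntermediateField.finiteDimensional_adjoin fun x _ => Algebra.IsIntegral.isIntegral x,
    fun γ i => ?_⟩
  rw [ratChar, charValue, ht, map_sum]
  refine sum_mem fun p hp => ?_
  rw [geomEval_tmul]
  refine mul_mem (IntermediateField.subset_adjoin _ _ ?_) (IntermediateField.algebraMap_mem _ _)
  exact Set.mem_iUnion.2 ⟨i, p, hp, rfl⟩

/-- The rational points lying in the maximal compact subgroups at all finite places outside `U`. -/
def rationalUnits (A : Type*) [CommRing A] [HopfAlgebra k A] (U : Set (FinitePlaces k)) :
    Subgroup (Points k A k) :=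
  (unitsOutside A U).comap (globalToAdelic k A)

theorem mem_rationalUnits_iff {U : Set (FinitePlaces k)} {γ : Points k A k} :
    γ ∈ rationalUnits A U ↔ ∀ v ∉ U, ∀ c, ‖placeEmbedding v (ratChar e γ c)‖ = 1 := by
  rw [rationalUnits, Subgroup.mem_comap, mem_unitsOutside]
  refine forall₂_congr fun v _ => ?_
  rw [map_adeleFiniteProj_globalToAdelic, mem_maxCompactSubgroup_iff e]
  exact forall_congr' fun c => by rw [absChar_map_ofId]

/-- The conjugates of c(γ) are the values at γ of the conjugate characters, so all of them are units
at every finite place. -/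
theorem isIntegral_ratChar {γ : Points k A k} (hγ : γ ∈ rationalUnits A ∅) (c : Fin n → ℤ) :
    IsIntegral ℤ (ratChar e γ c) := by
  have h1 : IsIntegral (𝓞 k) (ratChar e γ c) := by
    refine isIntegral_of_norm_le_one fun v σ => ?_
    rw [← ratChar_galAct]
    exact ((mem_rationalUnits_iff e).1 hγ v (Set.notMem_empty v) _).le
  exact isIntegral_trans _ h1

/-- The values of the characters at everywhere integral rational points, as units of `L`. -/
theorem exists_unitsHom (L : IntermediateField k (AlgebraicClosure k))
    (hL : ∀ γ i, ratChar e γ (Pi.single i 1) ∈ L) :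
    ∃ j : rationalUnits A (∅ : Set (FinitePlaces k)) →* (Fin n → (𝓞 L)ˣ),
      ∀ γ i, (((j γ i : 𝓞 L) : L) : AlgebraicClosure k) =
        ratChar e (γ : Points k A k) (Pi.single i 1) := by
  let j₀ (i : Fin n) : rationalUnits A (∅ : Set (FinitePlaces k)) →* 𝓞 L :=
    { toFun γ := ⟨⟨_, hL γ i⟩, (isIntegral_algebraMap_iff
        (algebraMap L (AlgebraicClosure k)).injective).1 (isIntegral_ratChar e γ.2 _)⟩
      map_one' := RingOfIntegers.ext (Subtype.ext (ratChar_one e _))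
      map_mul' γ δ := RingOfIntegers.ext (Subtype.ext (ratChar_mul e _ _ _)) }
  exact ⟨MonoidHom.pi fun i => (j₀ i).toHomUnits, fun γ i => rfl⟩

omit [NumberField k] in
/-- A character of `T` with values in `L` at the rational points and a complex embedding of `L` give
a continuous character of the group of archimedean points. -/
theorem exists_archimedean_character_of_mem (L : IntermediateField k (AlgebraicClosure k))
    (c : Fin n → ℤ) (hL : ∀ γ, ratChar e γ c ∈ L) (τ : L →+* ℂ) :
    ∃ X : Points k A (InfiniteAdeleRing k) →ₜ* ℂˣ, ∀ γ : Points k A k,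
      (X (Points.map (Algebra.ofId k _) γ) : ℂ) = τ ⟨ratChar e γ c, hL γ⟩ := by
  let _ : Algebra L ℂ := τ.toAlgebra
  let f : AlgebraicClosure k →ₐ[L] ℂ := IsAlgClosed.lift
  obtain ⟨X, hX⟩ := exists_archimedean_character e (f : AlgebraicClosure k →+* ℂ) c
  exact ⟨X, fun γ => (hX γ).trans (f.commutes ⟨_, hL γ⟩)⟩

include e in
/-- Every character of the everywhere integral rational points is the restriction of a continuous
character of the archimedean points. -/
theorem exists_archimedean_extension
    (ψ : rationalUnits A (∅ : Set (FinitePlaces k)) →* Circle) :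
    ∃ Ψ : Points k A (InfiniteAdeleRing k) →ₜ* Circle,
      ∀ γ : rationalUnits A (∅ : Set (FinitePlaces k)),
        Ψ (Points.map (Algebra.ofId k _) (γ : Points k A k)) = ψ γ := by
  classical
  obtain ⟨L, hfin, hL⟩ := exists_splittingField e
  have : NumberField L := NumberField.of_module_finite k L
  obtain ⟨j, hj⟩ := exists_unitsHom e L hL
  -- The map `j` is injective, since basis characters separate rational points; so `ψ` extends to
  -- all of (𝓞 L)ˣ to the power n.
  obtain ⟨ψ', hψ'⟩ := exists_circle_extension j ψ fun γ hγ => by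
    have : γ = 1 := Subtype.ext (eq_one_of_ratChar e _ fun i => by
      rw [← hj, hγ]
      rfl)
    rw [this, map_one]
  -- The extended character is a product of characters of the n factors; each is interpolated on ∏_τ
  -- ℂˣ and pulled back to T(k_∞) by the i-th basis character under all complex embeddings of L.
  choose P hP using fun i : Fin n =>
    exists_extension_units (ψ'.comp (MonoidHom.mulSingle (fun _ : Fin n => (𝓞 L)ˣ) i))
  choose X hX using fun (τ : L →+* ℂ) (i : Fin n) =>
    exists_archimedean_character_of_mem e L (Pi.single i 1) (fun γ => hL γ i) τ
  let Q (i : Fin n) : Points k A (InfiniteAdeleRing k) →* ((L →+* ℂ) → ℂˣ) :=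
    MonoidHom.pi fun τ => (X τ i : Points k A (InfiniteAdeleRing k) →* ℂˣ)
  have hQ (i : Fin n) : Continuous (Q i) := continuous_pi fun τ => (X τ i).continuous_toFun
  refine ⟨⟨∏ i, (P i : ((L →+* ℂ) → ℂˣ) →* Circle).comp (Q i), ?_⟩, fun γ => ?_⟩
  · refine (continuous_finsetProd Finset.univ fun i _ =>
      (P i).continuous_toFun.comp (hQ i)).congr fun x => ?_
    exact (MonoidHom.finsetProd_apply (fun i =>
      (P i : ((L →+* ℂ) → ℂˣ) →* Circle).comp (Q i)) Finset.univ x).symm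
  · refine Eq.trans (MonoidHom.finsetProd_apply (fun i =>
      (P i : ((L →+* ℂ) → ℂˣ) →* Circle).comp (Q i)) Finset.univ _) ?_
    rw [← hψ' γ, ← Finset.univ_prod_mulSingle (j γ), map_prod]
    refine Finset.prod_congr rfl fun i _ => ?_
    refine Eq.trans ?_ (hP i (j γ i))
    refine congrArg (P i) (funext fun τ => Units.ext ?_)
    refine (hX τ i γ).trans ?_
    exact congrArg τ (Subtype.ext (hj γ i).symm)

include e in
/-- A character of an open group of adelic points which is trivial on its rational points extends
to an automorphic character. -/
theorem exists_isAutomorphic {U : Set (FinitePlaces k)} (θ : unitsOutside A U →* Circle)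
    (hθ : Continuous θ) (Ψ : Points k A (InfiniteAdeleRing k) →ₜ* Circle)
    (h : ∀ (γ : Points k A k) (hγ : γ ∈ rationalUnits A U),
      θ ⟨globalToAdelic k A γ, hγ⟩ * Ψ (Points.map (Algebra.ofId k _) γ) = 1) :
    ∃ χ : AdelicPoints k A →ₜ* Circle, IsAutomorphic χ ∧ ∀ x : unitsOutside A U,
      Points.map adeleInfiniteProj (x : AdelicPoints k A) = 1 → χ x = θ x := by
  let p : unitsOutside A U →* Points k A (InfiniteAdeleRing k) :=
    (Points.map adeleInfiniteProj).comp (unitsOutside A U).subtype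
  have hp : Continuous p :=
    (Points.continuous_map _ continuous_adeleInfiniteProj).comp continuous_subtype_val
  obtain ⟨χ, h1, h2⟩ := exists_continuous_extension (points_mul_comm e) (globalToAdelic k A)
    (unitsOutside A U) (isOpen_unitsOutside e U)
    (θ * (Ψ : Points k A (InfiniteAdeleRing k) →* Circle).comp p)
    (hθ.mul (Ψ.continuous_toFun.comp hp)) h
  refine ⟨χ, h1, fun x hx => (h2 x).trans ?_⟩
  change θ x * Ψ (Points.map adeleInfiniteProj (x : AdelicPoints k A)) = θ x
  rw [hx, map_one, mul_one]

/-! ### Local components of adelic points and the first extension theorem -/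

/-- The projection of adelic points to the product of the components at the places in `S`. -/
def adelicToSemilocal (A : Type*) [CommRing A] [HopfAlgebra k A] (S : Finset (FinitePlaces k)) :
    AdelicPoints k A →* SemilocalPoints k A S :=
  MonoidHom.pi fun v => Points.map (adeleFiniteProj v.1)

theorem continuous_adelicToSemilocal (S : Finset (FinitePlaces k)) :
    Continuous (adelicToSemilocal A S) :=
  continuous_pi fun v => Points.continuous_map _ (continuous_adeleFiniteProj v.1)

theorem map_adeleFiniteProj_semilocalToAdelic_of_mem {S : Finset (FinitePlaces k)}
    (x : SemilocalPoints k A S) {v : FinitePlaces k} (hv : v ∈ S) :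
    Points.map (adeleFiniteProj v) (semilocalToAdelic S x) = x ⟨v, hv⟩ :=
  dif_pos hv

theorem map_adeleFiniteProj_semilocalToAdelic_of_notMem {S : Finset (FinitePlaces k)}
    (x : SemilocalPoints k A S) {v : FinitePlaces k} (hv : v ∉ S) :
    Points.map (adeleFiniteProj v) (semilocalToAdelic S x) = 1 :=
  dif_neg hv

theorem map_adeleInfiniteProj_semilocalToAdelic {S : Finset (FinitePlaces k)}
    (x : SemilocalPoints k A S) :
    Points.map adeleInfiniteProj (semilocalToAdelic S x) = 1 := rfl

theorem map_adeleFiniteProj_localToAdelic_self (v : FinitePlaces k) (x : LocalPoints k A v) :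
    Points.map (adeleFiniteProj v) (localToAdelic v x) = x := by
  classical
  exact Pi.mulSingle_eq_same (M := fun v => LocalPoints k A v) v x

theorem map_adeleFiniteProj_localToAdelic_of_ne {v w : FinitePlaces k} (h : w ≠ v)
    (x : LocalPoints k A v) : Points.map (adeleFiniteProj w) (localToAdelic v x) = 1 :=
  open Classical in Pi.mulSingle_eq_of_ne (M := fun v => LocalPoints k A v) h x

theorem map_adeleInfiniteProj_localToAdelic (v : FinitePlaces k) (x : LocalPoints k A v) :
    Points.map adeleInfiniteProj (localToAdelic v x) = 1 := rfl

theorem localToAdelic_mem_unitsOutside {v : FinitePlaces k} {x : LocalPoints k A v}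
    (hx : x ∈ maxCompactSubgroup (LocalPoints k A v)) (U : Set (FinitePlaces k)) :
    localToAdelic v x ∈ unitsOutside A U := by
  refine mem_unitsOutside.2 fun w _ => ?_
  by_cases h : w = v
  · subst h
    rwa [map_adeleFiniteProj_localToAdelic_self]
  · rw [map_adeleFiniteProj_localToAdelic_of_ne h]
    exact one_mem _

include e in
theorem exists_automorphic_extension_maxCompactSubgroup (S : Finset (FinitePlaces k))
    (χS : maxCompactSubgroup (SemilocalPoints k A S) →ₜ* ℂˣ) :
    ∃ χ' : AdelicPoints k A →ₜ* Circle, IsAutomorphic χ' ∧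
      (∀ x : maxCompactSubgroup (SemilocalPoints k A S),
        (χ' (semilocalToAdelic S (x : SemilocalPoints k A S)) : ℂ) = (χS x : ℂ)) ∧
      ∀ v, v ∉ S → IsUnramifiedAt χ' v := by
  let q : unitsOutside A (∅ : Set (FinitePlaces k)) →*
      maxCompactSubgroup (SemilocalPoints k A S) :=
    ((adelicToSemilocal A S).comp (unitsOutside A ∅).subtype).codRestrict _ fun x =>
      (mem_maxCompactSubgroup_semilocal e S _).2 fun v => mem_unitsOutside.1 x.2 v (by simp)
  have hq : Continuous q :=
    ((continuous_adelicToSemilocal S).comp continuous_subtype_val).subtype_mk _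
  -- `χS` takes values of norm 1 by compactness, so normalising it changes nothing and makes it
  -- circle-valued.
  let ω : maxCompactSubgroup (SemilocalPoints k A S) →ₜ* Circle := unitsToCircle.comp χS
  have hω (x) : (ω x : ℂ) = χS x := by
    refine (coe_unitsToCircle _).trans ?_
    change (χS x : ℂ) / ‖(χS x : ℂ)‖ = χS x
    rw [norm_eq_one_of_isCompact (isCompact_maxCompactSubgroup_semilocal e S)]
    simp
  let θ : unitsOutside A (∅ : Set (FinitePlaces k)) →* Circle :=
    (ω : maxCompactSubgroup (SemilocalPoints k A S) →* Circle).comp q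
  let g : rationalUnits A (∅ : Set (FinitePlaces k)) →*
      unitsOutside A (∅ : Set (FinitePlaces k)) :=
    ((globalToAdelic k A).comp (rationalUnits A ∅).subtype).codRestrict _ fun γ => γ.2
  -- The inverse is interpolated so that `Ψ` cancels `θ` on the rational points. `Ψ` sees only the
  -- infinite components, so the values on `semilocalToAdelic` and the ramification are those of
  -- `θ`.
  obtain ⟨Ψ, hΨ⟩ := exists_archimedean_extension e (θ.comp g)⁻¹
  obtain ⟨χ, h1, h2⟩ := exists_isAutomorphic e θ (ω.continuous_toFun.comp hq) Ψ fun γ hγ => by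
    rw [hΨ ⟨γ, hγ⟩, MonoidHom.inv_apply]
    exact mul_inv_cancel _
  refine ⟨χ, h1, fun x => ?_, fun v hv x hx => ?_⟩
  · have hx : semilocalToAdelic S (x : SemilocalPoints k A S) ∈
        unitsOutside A (∅ : Set (FinitePlaces k)) := by
      refine mem_unitsOutside.2 fun v _ => ?_
      by_cases hv : v ∈ S
      · rw [map_adeleFiniteProj_semilocalToAdelic_of_mem _ hv]
        exact (mem_maxCompactSubgroup_semilocal e S _).1 x.2 ⟨v, hv⟩
      · rw [map_adeleFiniteProj_semilocalToAdelic_of_notMem _ hv]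
        exact one_mem _
    have h3 : q ⟨_, hx⟩ = x := Subtype.ext (funext fun v =>
      map_adeleFiniteProj_semilocalToAdelic_of_mem _ v.2)
    rw [h2 ⟨_, hx⟩ (map_adeleInfiniteProj_semilocalToAdelic _), ← hω]
    exact congrArg (fun y => (ω y : ℂ)) h3
  · have hx' := localToAdelic_mem_unitsOutside hx ∅
    have h3 : q ⟨_, hx'⟩ = 1 := Subtype.ext (funext fun w =>
      map_adeleFiniteProj_localToAdelic_of_ne (fun h : w.1 = v => hv (h ▸ w.2)) _)
    rw [h2 ⟨_, hx'⟩ (map_adeleInfiniteProj_localToAdelic _ _)]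
    exact (congrArg ω h3).trans (map_one ω)

end FirstPart

end

/-! ### Galois descent for points -/

section Descent

variable {K : Type*} [Field K] {R : Type*} [CommRing R] [Algebra K R]

/-- Galois descent for elements of a tensor product. -/
theorem exists_one_tmul_eq_of_fixed [PerfectField K] {z : AlgebraicClosure K ⊗[K] R}
    (hz : ∀ σ : AlgebraicClosure K ≃ₐ[K] AlgebraicClosure K,
      Algebra.TensorProduct.map (σ : AlgebraicClosure K →ₐ[K] AlgebraicClosure K)
        (AlgHom.id K R) z = z) : ∃ r : R, 1 ⊗ₜ r = z := by
  let b := Module.Basis.ofVectorSpace K R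
  let B := Algebra.TensorProduct.basis (AlgebraicClosure K) b
  have h1 (σ : AlgebraicClosure K ≃ₐ[K] AlgebraicClosure K) (i) (y : AlgebraicClosure K ⊗[K] R) :
      B.repr (Algebra.TensorProduct.map (σ : AlgebraicClosure K →ₐ[K] AlgebraicClosure K)
        (AlgHom.id K R) y) i = σ (B.repr y i) := by
    induction y with
    | zero => simp
    | add y z hy hz => simp only [map_add, Finsupp.add_apply, hy, hz]
    | tmul l r => simp [B]
  -- The coordinates in a K-basis of `R` are Galois-fixed, and over a perfect field the fixed
  -- elements of the algebraic closure are those of K.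
  have h2 (i) : ∃ c : K, algebraMap K _ c = B.repr z i := by
    refine IntermediateField.mem_bot.1 ((InfiniteGalois.mem_bot_iff_fixed _).2 fun σ => ?_)
    have := h1 σ i z
    rw [hz] at this
    exact this.symm
  choose c hc using h2
  refine ⟨∑ i ∈ (B.repr z).support, c i • b i, ?_⟩
  conv_rhs => rw [← B.linearCombination_repr z]
  rw [TensorProduct.tmul_sum, Finsupp.linearCombination_apply, Finsupp.sum]
  refine Finset.sum_congr rfl fun i _ => ?_
  rw [← hc, algebraMap_smul, TensorProduct.tmul_smul]
  congr 1
  exact (Algebra.TensorProduct.basis_apply b i).symm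

variable {k A : Type*} [Field k] [CommRing A] [HopfAlgebra k A] [Algebra k K] [Algebra k R]
  [IsScalarTower k K R] {n : ℕ}
  (e : AlgebraicClosure k ⊗[k] A ≃ₐc[AlgebraicClosure k]
    SplitTorusRing (AlgebraicClosure k) n)

variable (K R k) in
/-- The inclusion of `R` in its base change to the algebraic closure of `K`. -/
def closureInclusion : R →ₐ[k] AlgebraicClosure K ⊗[K] R :=
  (Algebra.TensorProduct.includeRight : R →ₐ[K] AlgebraicClosure K ⊗[K] R).restrictScalars k

theorem closureInclusion_injective : Function.Injective (closureInclusion K R k) :=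
  Algebra.TensorProduct.includeRight_injective (FaithfulSMul.algebraMap_injective K _)

variable (ι : AlgebraicClosure k →ₐ[k] AlgebraicClosure K)

variable (R) in
/-- The embedding of the algebraic closure of `k` in the base change of `R`. -/
def closureScalars : AlgebraicClosure k →ₐ[k] AlgebraicClosure K ⊗[K] R :=
  ((Algebra.TensorProduct.includeLeft :
    AlgebraicClosure K →ₐ[K] AlgebraicClosure K ⊗[K] R).restrictScalars k).comp ι

/-- The value of a character at a point over a `K`-algebra, in the base change to the algebraic
closure of `K`. -/
def closureChar (x : Points k A R) (c : Fin n → ℤ) : AlgebraicClosure K ⊗[K] R :=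
  charValue e (closureScalars R ι) (Points.map (closureInclusion K R k) x) c

theorem closureChar_mul (x y : Points k A R) (c : Fin n → ℤ) :
    closureChar e ι (x * y) c = closureChar e ι x c * closureChar e ι y c := by
  rw [closureChar, map_mul, charValue_mul]
  rfl

theorem closureChar_one (c : Fin n → ℤ) : closureChar e ι (1 : Points k A R) c = 1 := by
  rw [closureChar, map_one, charValue_one]

theorem ext_closureChar {x y : Points k A R} (h : ∀ c, closureChar e ι x c = closureChar e ι y c) :
    x = y :=
  Points.map_injective _ closureInclusion_injective (ext_charValue e _ h)

theorem closureChar_map {R' : Type*} [CommRing R'] [Algebra K R'] [Algebra k R']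
    [IsScalarTower k K R'] (φ : R →ₐ[K] R') (x : Points k A R) (c : Fin n → ℤ) :
    closureChar e ι (Points.map (φ.restrictScalars k) x) c =
      Algebra.TensorProduct.map (AlgHom.id K _) φ (closureChar e ι x c) := by
  let Φ : AlgebraicClosure K ⊗[K] R →ₐ[k] AlgebraicClosure K ⊗[K] R' :=
    (Algebra.TensorProduct.map (AlgHom.id K (AlgebraicClosure K)) φ).restrictScalars k
  have h1 : Φ.comp (closureScalars R ι) = closureScalars R' ι := by
    ext l
    simp [Φ, closureScalars]
  have h2 : Φ.comp (closureInclusion K R k) =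
      (closureInclusion K R' k).comp (φ.restrictScalars k) := by
    ext l
    simp [Φ, closureInclusion]
  rw [closureChar, ← h1, ← Points.map_comp, ← h2, Points.map_comp]
  exact charValue_map e (closureScalars R ι) Φ _ c

/-- A multiplicative function on the character lattice comes from a point. -/
theorem exists_point_charValue {E : Type*} [CommRing E] [Algebra k E]
    (ι : AlgebraicClosure k →ₐ[k] E) (w : Multiplicative (Fin n → ℤ) →* E) :
    ∃ x : Points k A E, ∀ c, charValue e ι x c = w (Multiplicative.ofAdd c) := by
  let _ : Algebra (AlgebraicClosure k) E := ι.toRingHom.toAlgebra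
  have : IsScalarTower k (AlgebraicClosure k) E :=
    .of_algebraMap_eq fun c => (ι.commutes c).symm
  let Φ : SplitTorusRing (AlgebraicClosure k) n →ₐ[AlgebraicClosure k] E :=
    AddMonoidAlgebra.lift _ _ _ w
  let Ψ : AlgebraicClosure k ⊗[k] A →ₐ[AlgebraicClosure k] E := Φ.comp (e : _ →ₐ[_] _)
  let x : Points k A E := Points.ofAlgHom
    ((Ψ.restrictScalars k).comp Algebra.TensorProduct.includeRight)
  have h (z : AlgebraicClosure k ⊗[k] A) : geomEval ι x z = Ψ z := by
    induction z with
    | zero => simp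
    | add y z hy hz => simp only [map_add, hy, hz]
    | tmul l a =>
      have : l ⊗ₜ[k] a = l • ((1 : AlgebraicClosure k) ⊗ₜ[k] a) := by
        rw [TensorProduct.smul_tmul', smul_eq_mul, mul_one]
      rw [geomEval_tmul, this, map_smul, Algebra.smul_def]
      rfl
  refine ⟨x, fun c => ?_⟩
  rw [charValue, h]
  change Φ (e (groupLike e c)) = _
  rw [apply_groupLike]
  simp [Φ]

theorem galAct_galAct_symm (s : AlgebraicClosure k ≃ₐ[k] AlgebraicClosure k) (c : Fin n → ℤ) :
    galAct e s (galAct e s.symm c) = c := by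
  apply groupLike_injective e
  rw [groupLike_galAct, groupLike_galAct]
  generalize groupLike e c = z
  induction z with
  | zero => simp
  | add y z hy hz => simp only [map_add, hy, hz]
  | tmul l a => simp [galTensor]

/-- Automorphisms of the algebraic closure of `K` restrict to that of `k`. -/
theorem exists_algEquiv_restrict [CharZero k] (σ : AlgebraicClosure K ≃ₐ[K] AlgebraicClosure K) :
    ∃ s : AlgebraicClosure k ≃ₐ[k] AlgebraicClosure k, ∀ x, ι (s x) = σ (ι x) := by
  let _ : Algebra (AlgebraicClosure k) (AlgebraicClosure K) := ι.toRingHom.toAlgebra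
  have : IsScalarTower k (AlgebraicClosure k) (AlgebraicClosure K) :=
    .of_algebraMap_eq fun c => (ι.commutes c).symm
  exact ⟨(σ.restrictScalars k).restrictNormal (AlgebraicClosure k),
    fun x => AlgEquiv.restrictNormal_commutes (σ.restrictScalars k) (AlgebraicClosure k) x⟩

/-- A Galois invariant multiplicative function on the character lattice with values in `R` comes
from a point over `R`. -/
theorem exists_point_closureChar [PerfectField K] [CharZero k] (w : Multiplicative (Fin n → ℤ) →* R)
    (hw : ∀ (σ : AlgebraicClosure K ≃ₐ[K] AlgebraicClosure K)
      (s : AlgebraicClosure k ≃ₐ[k] AlgebraicClosure k), (∀ x, ι (s x) = σ (ι x)) →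
      ∀ c, w (Multiplicative.ofAdd (galAct e s c)) = w (Multiplicative.ofAdd c)) :
    ∃ x : Points k A R, ∀ c, closureChar e ι x c = 1 ⊗ₜ w (Multiplicative.ofAdd c) := by
  obtain ⟨y, hy⟩ := exists_point_charValue e (closureScalars R ι)
    ((closureInclusion K R k : R →* AlgebraicClosure K ⊗[K] R).comp w)
  have hy' (c) : charValue e (closureScalars R ι) y c = 1 ⊗ₜ w (Multiplicative.ofAdd c) := hy c
  have hfix (σ : AlgebraicClosure K ≃ₐ[K] AlgebraicClosure K) (a : A) :
      Algebra.TensorProduct.map (σ : AlgebraicClosure K →ₐ[K] AlgebraicClosure K)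
        (AlgHom.id K R) (y.eval a) = y.eval a := by
    let Φ : AlgebraicClosure K ⊗[K] R →ₐ[k] AlgebraicClosure K ⊗[K] R :=
      (Algebra.TensorProduct.map (σ : AlgebraicClosure K →ₐ[K] AlgebraicClosure K)
        (AlgHom.id K R)).restrictScalars k
    suffices h : Points.map Φ y = y from congrArg (fun z => z.eval a) h
    obtain ⟨s, hs⟩ := exists_algEquiv_restrict ι σ
    have hΦ : Φ.comp (closureScalars R ι) =
        (closureScalars R ι).comp (s : AlgebraicClosure k →ₐ[k] AlgebraicClosure k) := by
      ext l
      simp [Φ, closureScalars, hs]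
    refine ext_charValue e (closureScalars R ι) fun c => ?_
    -- Writing c as s(s⁻¹c) lets s pass from the character to the embedding, where it becomes `Φ`.
    -- Then `Φ` fixes 1 ⊗ w, and `hw` identifies the two values of w.
    rw [← galAct_galAct_symm e s c, ← charValue_comp_algEquiv, ← hΦ, charValue_map, hy', hy',
      hw σ s hs]
    simp [Φ]
  choose r hr using fun a => exists_one_tmul_eq_of_fixed fun σ => hfix σ a
  have hinj : Function.Injective (closureInclusion K R k) := closureInclusion_injective
  have hr' (a) : closureInclusion K R k (r a) = y.toAlgHom a := hr a
  let x : Points k A R := Points.ofAlgHom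
    { toFun := r
      map_one' := hinj (by rw [hr', map_one, map_one])
      map_mul' a b := hinj (by rw [hr', map_mul, map_mul, hr', hr'])
      map_zero' := hinj (by rw [hr', map_zero, map_zero])
      map_add' a b := hinj (by rw [hr', map_add, map_add, hr', hr'])
      commutes' c := hinj (by rw [hr', AlgHom.commutes, AlgHom.commutes]) }
  have hx : Points.map (closureInclusion K R k) x = y :=
    Points.eval_injective (funext hr)
  exact ⟨x, fun c => by rw [closureChar, hx, hy']⟩

end Descent

/-! ### Split quotients of the character lattice and split subtori -/

section SplitSubtorus

variable {k A : Type*} [Field k] [CommRing A] [HopfAlgebra k A] {n : ℕ}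
  (e : AlgebraicClosure k ⊗[k] A ≃ₐc[AlgebraicClosure k]
    SplitTorusRing (AlgebraicClosure k) n)
  {K : Type*} [Field K] [Algebra k K] (ι : AlgebraicClosure k →ₐ[k] AlgebraicClosure K)
  {s : ℕ}

/-- A point over the group algebra of a lattice at which the characters are monomials is a
homomorphism of group schemes. -/
theorem exists_bialgHom (x : Points k A (SplitTorusRing K s)) (ℓ : (Fin n → ℤ) →+ (Fin s → ℤ))
    (hx : ∀ c, closureChar e ι x c = 1 ⊗ₜ AddMonoidAlgebra.single (ℓ c) 1) :
    ∃ F : K ⊗[k] A →ₐc[K] SplitTorusRing K s, ∀ l a, F (l ⊗ₜ a) = l • x.eval a := by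
  let F : K ⊗[k] A →ₐ[K] SplitTorusRing K s :=
    Algebra.TensorProduct.lift (Algebra.ofId K _) x.toAlgHom fun _ _ => .all ..
  have hF (l : K) (a : A) : F (l ⊗ₜ a) = l • x.eval a := by
    rw [Algebra.smul_def]
    exact Algebra.TensorProduct.lift_tmul ..
  have hF1 (a : A) : F (1 ⊗ₜ a) = x.eval a := by rw [hF, one_smul]
  -- Compatibility with counit and comultiplication is restated as two identities between points. On
  -- characters these say that monomials are group-like.
  have h1 : Points.map ((Bialgebra.counitAlgHom K (SplitTorusRing K s)).restrictScalars k) x =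
      1 := by
    refine ext_closureChar e ι fun c => ?_
    rw [closureChar_map, hx, closureChar_one]
    simp [Algebra.TensorProduct.one_def]
  let i₁ : SplitTorusRing K s →ₐ[K] SplitTorusRing K s ⊗[K] SplitTorusRing K s :=
    Algebra.TensorProduct.includeLeft
  let i₂ : SplitTorusRing K s →ₐ[K] SplitTorusRing K s ⊗[K] SplitTorusRing K s :=
    Algebra.TensorProduct.includeRight
  have h2 : Points.map ((Bialgebra.comulAlgHom K (SplitTorusRing K s)).restrictScalars k) x =
      Points.map (i₁.restrictScalars k) x * Points.map (i₂.restrictScalars k) x := by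
    refine ext_closureChar e ι fun c => ?_
    rw [closureChar_mul, closureChar_map, closureChar_map, closureChar_map, hx]
    simp [i₁, i₂]
  refine ⟨BialgHom.ofAlgHom F ?_ ?_, hF⟩
  · refine Algebra.TensorProduct.ext (by ext) (AlgHom.ext fun a => ?_)
    have := congrArg (fun y => y.eval a) h1
    change Coalgebra.counit (R := K) (F (1 ⊗ₜ a)) = Coalgebra.counit (R := K) ((1 : K) ⊗ₜ[k] a)
    rw [hF1, TensorProduct.counit_tmul]
    refine this.trans ?_
    rw [Points.eval_one, Algebra.smul_def]
    simp
  · refine Algebra.TensorProduct.ext (by ext) (AlgHom.ext fun a => ?_)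
    have := congrArg (fun y => y.eval a) h2
    let r := Coalgebra.Repr.arbitrary k a
    simp only [Points.eval_mul_repr _ _ r] at this
    change Algebra.TensorProduct.map F F (Coalgebra.comul (R := K) ((1 : K) ⊗ₜ[k] a)) =
      Coalgebra.comul (R := K) (F (1 ⊗ₜ a))
    rw [hF1]
    refine Eq.trans ?_ this.symm
    rw [TensorProduct.comul_tmul, ← r.eq, TensorProduct.tmul_sum, map_sum, map_sum]
    refine Finset.sum_congr rfl fun j _ => ?_
    simp [hF1, i₁, i₂, Points.eval_map]

/-- If the characters at a point over a group algebra are all the monomials, the coordinates span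
the group algebra. -/
theorem surjective_of_closureChar (x : Points k A (SplitTorusRing K s))
    (ℓ : (Fin n → ℤ) →+ (Fin s → ℤ)) (hℓ : Function.Surjective ℓ)
    (hx : ∀ c, closureChar e ι x c = 1 ⊗ₜ AddMonoidAlgebra.single (ℓ c) 1)
    (F : K ⊗[k] A →ₗ[K] SplitTorusRing K s) (hF : ∀ l a, F (l ⊗ₜ a) = l • x.eval a) :
    Function.Surjective F := by
  -- A K-linear retraction of K̄ onto K recovers the monomial from its image in the base change, and
  -- sends each ι l ⊗ x(a) to a K-multiple of x(a), which is in the range of `F`.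
  obtain ⟨ρ, hρ⟩ := (Algebra.linearMap K (AlgebraicClosure K)).exists_leftInverse_of_injective
    (LinearMap.ker_eq_bot.2 (algebraMap K (AlgebraicClosure K)).injective)
  have hρ1 : ρ 1 = 1 := by
    have := DFunLike.congr_fun hρ 1
    simpa using this
  let D : AlgebraicClosure K ⊗[K] SplitTorusRing K s →ₗ[K] SplitTorusRing K s :=
    TensorProduct.lift ((LinearMap.lsmul K (SplitTorusRing K s)).comp ρ)
  have hD (l : AlgebraicClosure K) (r : SplitTorusRing K s) : D (l ⊗ₜ r) = ρ l • r := by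
    simp [D]
  have key (c : Fin n → ℤ) : AddMonoidAlgebra.single (ℓ c) (1 : K) ∈ LinearMap.range F := by
    have h1 : AddMonoidAlgebra.single (ℓ c) (1 : K) = D (closureChar e ι x c) := by
      rw [hx, hD, hρ1, one_smul]
    rw [h1, closureChar, charValue]
    generalize groupLike e c = z
    induction z with
    | zero => simp only [map_zero]; exact zero_mem _
    | add y z hy hz => simp only [map_add]; exact add_mem hy hz
    | tmul l a =>
      rw [geomEval_tmul]
      have : closureScalars (SplitTorusRing K s) ι l *
          (Points.map (closureInclusion K (SplitTorusRing K s) k) x).eval a =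
            ι l ⊗ₜ[K] x.eval a := by
        simp [closureScalars, closureInclusion, Points.eval_map]
      rw [this, hD, ← hF]
      exact ⟨_, rfl⟩
  intro y
  change y ∈ LinearMap.range F
  rw [← AddMonoidAlgebra.sum_coeff_single y, Finsupp.sum]
  refine sum_mem fun m _ => ?_
  obtain ⟨c, rfl⟩ := hℓ m
  have : AddMonoidAlgebra.single (ℓ c) (y.coeff (ℓ c)) =
      y.coeff (ℓ c) • AddMonoidAlgebra.single (ℓ c) (1 : K) := by simp
  rw [this]
  exact Submodule.smul_mem _ _ (key c)

/-- If the formation of the maximal split subtorus commutes with the base change from `k` to `K`,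
then Galois invariance of a map from the character lattice to another lattice over `K` implies
Galois invariance over `k`. -/
theorem galAct_invariant_of_splitPartCompatible [CharZero k] [PerfectField K]
    (h : SplitPartCompatible k A K)
    (ℓ : (Fin n → ℤ) →+ (Fin s → ℤ)) (hℓ : Function.Surjective ℓ)
    (hinv : ∀ (σ : AlgebraicClosure K ≃ₐ[K] AlgebraicClosure K)
      (t : AlgebraicClosure k ≃ₐ[k] AlgebraicClosure k), (∀ x, ι (t x) = σ (ι x)) →
      ∀ c, ℓ (galAct e t c) = ℓ c)
    (t : AlgebraicClosure k ≃ₐ[k] AlgebraicClosure k) (c : Fin n → ℤ) :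
    ℓ (galAct e t c) = ℓ c := by
  obtain ⟨I, ⟨⟨r, π, hπ, hI⟩, -⟩, -, hleast⟩ := h
  -- The universal point of the homomorphism 𝔾_m^s → T over K dual to `ℓ`; local invariance of `ℓ`
  -- lets it descend from K̄ to K.
  obtain ⟨x, hx⟩ := exists_point_closureChar e ι
    ((AddMonoidAlgebra.of K (Fin s → ℤ)).comp ℓ.toMultiplicative) fun σ t ht c =>
      congrArg (AddMonoidAlgebra.of K (Fin s → ℤ)) (congrArg Multiplicative.ofAdd (hinv σ t ht c))
  replace hx (c) : closureChar e ι x c = 1 ⊗ₜ AddMonoidAlgebra.single (ℓ c) 1 := hx c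
  obtain ⟨F, hF⟩ := exists_bialgHom e ι x ℓ hx
  -- Surjectivity of `ℓ` makes this a closed immersion, hence a split subtorus over K. By
  -- compatibility it lies in the base change of A_T.
  have hle := hleast (show RingHom.ker (F : K ⊗[k] A →ₐ[K] SplitTorusRing K s) ∈ _ from
    ⟨s, F, surjective_of_closureChar e ι x ℓ hℓ hx (F : K ⊗[k] A →ₗ[K] SplitTorusRing K s) hF,
      rfl⟩)
  have hIx (a : A) (ha : a ∈ I) : x.eval a = 0 := by
    have : F (1 ⊗ₜ a) = 0 := hle (Ideal.mem_map_of_mem _ ha)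
    rwa [hF, one_smul] at this
  -- The kernel of restriction to A_T over k̄ is generated by `I`, so evaluation at `x` factors
  -- through A_T, whose characters do not feel the Galois group of k.
  have hker : RingHom.ker (geomRestrict π) ≤
      RingHom.ker (geomEval (closureScalars (SplitTorusRing K s) ι)
        (Points.map (closureInclusion K (SplitTorusRing K s) k) x)) := by
    have h1 := Algebra.TensorProduct.lTensor_ker (A := AlgebraicClosure k)
      (π : A →ₐ[k] SplitTorusRing k r) hπ
    refine le_trans (le_of_eq (Eq.trans ?_ h1)) (Ideal.map_le_iff_le_comap.2 fun a ha => ?_)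
    · ext z
      rfl
    · rw [hI] at ha
      rw [Ideal.mem_comap, RingHom.mem_ker]
      refine (geomEval_one_tmul _ _ a).trans ?_
      rw [Points.eval_map, hIx a ha, map_zero]
  have hmem : groupLike e (galAct e t c) - groupLike e c ∈
      RingHom.ker (geomRestrict π) := by
    rw [RingHom.mem_ker, map_sub, sub_eq_zero]
    exact geomRestrict_groupLike_galAct e π t c
  have h2 := hker hmem
  rw [RingHom.mem_ker, map_sub, sub_eq_zero] at h2
  have h3 : closureChar e ι x (galAct e t c) = closureChar e ι x c := h2
  rw [hx, hx] at h3
  have h4 := closureInclusion_injective (k := k) h3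
  exact AddMonoidAlgebra.single_left_injective one_ne_zero h4

end SplitSubtorus

section

attribute [local instance] algClosureNormedField

/-! ### Absolute values of characters and the split part -/

section LogChar

variable {k A : Type*} [Field k] [CharZero k] [CommRing A] [HopfAlgebra k A] {n : ℕ}
  (e : AlgebraicClosure k ⊗[k] A ≃ₐc[AlgebraicClosure k]
    SplitTorusRing (AlgebraicClosure k) n)

/-- The image in ℝ is finitely generated and torsion-free, hence free over ℤ. Replacing it by ℤ^s
turns real absolute values into an integral map of lattices. -/
theorem exists_split_addMonoidHom (f : (Fin n → ℤ) →+ ℝ) :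
    ∃ (s : ℕ) (ℓ : (Fin n → ℤ) →+ (Fin s → ℤ)), Function.Surjective ℓ ∧
      ∀ c d, ℓ c = ℓ d ↔ f c = f d := by
  have : Module.Finite ℤ f.range :=
    Module.Finite.of_surjective f.rangeRestrict.toIntLinearMap f.rangeRestrict_surjective
  let b := Module.finBasis ℤ f.range
  refine ⟨_, (b.equivFun.toLinearMap.toAddMonoidHom).comp f.rangeRestrict,
    b.equivFun.surjective.comp f.rangeRestrict_surjective, fun c d => ?_⟩
  refine b.equivFun.injective.eq_iff.trans ?_
  exact Subtype.ext_iff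

variable {K : Type*} [NontriviallyNormedField K] [IsUltrametricDist K] [CompleteSpace K]
  [PerfectField K] [Algebra k K] (ι : AlgebraicClosure k →ₐ[k] AlgebraicClosure K)

-- σ fixes the coordinates of a K-point and preserves the unique extension of the absolute value to
-- K̄.
omit [CharZero k] [PerfectField K] in
theorem absChar_galAct_of_commutes (σ : AlgebraicClosure K ≃ₐ[K] AlgebraicClosure K)
    (t : AlgebraicClosure k ≃ₐ[k] AlgebraicClosure k) (h : ∀ x, ι (t x) = σ (ι x))
    (x : Points k A K) (c : Fin n → ℤ) :
    absChar e ι x (galAct e t c) = absChar e ι x c := by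
  let σ' : AlgebraicClosure K →ₐ[k] AlgebraicClosure K :=
    (σ : AlgebraicClosure K →ₐ[K] AlgebraicClosure K).restrictScalars k
  have h1 : ι.comp (t : AlgebraicClosure k →ₐ[k] AlgebraicClosure k) = σ'.comp ι :=
    AlgHom.ext h
  have h2 : σ'.comp (IsScalarTower.toAlgHom k K (AlgebraicClosure K)) =
      IsScalarTower.toAlgHom k K (AlgebraicClosure K) := AlgHom.ext fun y => σ.commutes y
  rw [absChar, ← charValue_comp_algEquiv, h1]
  conv_lhs => rw [← h2, Points.map_comp, charValue_map]
  exact norm_algClosure_algEquiv σ _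

/-- If the formation of the maximal split subtorus commutes with base change to `K`, the absolute
values of the characters at points over `K` are Galois invariant. -/
theorem absChar_galAct (h : SplitPartCompatible k A K)
    (t : AlgebraicClosure k ≃ₐ[k] AlgebraicClosure k) (x : Points k A K) (c : Fin n → ℤ) :
    absChar e ι x (galAct e t c) = absChar e ι x c := by
  obtain ⟨s, ℓ, hℓ, hiff⟩ := exists_split_addMonoidHom (logChar e ι x)
  have h1 := galAct_invariant_of_splitPartCompatible e ι h ℓ hℓ (fun σ t ht c =>
    (hiff _ _).2 (congrArg Real.log (absChar_galAct_of_commutes e ι σ t ht x c))) t c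
  exact Real.log_injOn_pos (absChar_pos e ι x _) (absChar_pos e ι x _) ((hiff _ _).1 h1)

end LogChar

/-! ### Norms of algebraic numbers -/

section Norms

variable {k : Type*} [Field k] [NumberField k]

/-- The absolute value is normalised by the order of the residue field, so its value group consists
of powers of that order. -/
theorem exists_zpow_eq_norm (v : FinitePlaces k) {z : k} (hz : z ≠ 0) :
    ∃ m : ℤ, ‖algebraMap k (v.adicCompletion k) z‖ = (Ideal.absNorm v.asIdeal : ℝ) ^ m := by
  have h1 : v.valuation k z ≠ 0 := (v.valuation k).ne_zero_iff.2 hz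
  refine ⟨(WithZero.unzero h1).toAdd, ?_⟩
  refine (FinitePlace.norm_embedding' v z).trans ?_
  rw [WithZeroMulInt.toNNReal_neg_apply _ h1]
  simp

theorem exists_algEquiv_eq (L : IntermediateField k (AlgebraicClosure k))
    (τ : L →ₐ[k] AlgebraicClosure k) (a : L) :
    ∃ σ : AlgebraicClosure k ≃ₐ[k] AlgebraicClosure k, σ a = τ a := by
  refine minpoly.exists_algEquiv_of_root' (Algebra.IsAlgebraic.isAlgebraic _) ?_
  have h1 : Polynomial.aeval a (minpoly k (a : AlgebraicClosure k)) = 0 := by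
    apply (algebraMap L (AlgebraicClosure k)).injective
    rw [map_zero, ← Polynomial.aeval_algebraMap_apply]
    exact minpoly.aeval _ _
  rw [Polynomial.aeval_algHom_apply, h1, map_zero]

variable {L : IntermediateField k (AlgebraicClosure k)} [FiniteDimensional k L]

/-- The norm is the product of the images of a under the [L : k] embeddings of L in k̄, each of
which agrees at a with some automorphism of k̄. -/
theorem norm_placeEmbedding_norm (v : FinitePlaces k) (a : L) (r : ℝ)
    (h : ∀ σ : AlgebraicClosure k ≃ₐ[k] AlgebraicClosure k, ‖placeEmbedding v (σ a)‖ = r) :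
    ‖algebraMap k (v.adicCompletion k) (Algebra.norm k a)‖ = r ^ Module.finrank k L := by
  rw [← norm_placeEmbedding_algebraMap,
    Algebra.norm_eq_prod_embeddings k (AlgebraicClosure k), map_prod, norm_prod]
  rw [Finset.prod_congr rfl fun τ _ => ?_, Finset.prod_const, Finset.card_univ, AlgHom.card]
  obtain ⟨σ, hσ⟩ := exists_algEquiv_eq L τ a
  rw [← hσ, h]

/-- The product formula, in which u is the only contributing finite place. -/
theorem norm_eq_inv_abs_norm_of_forall_ne (u : FinitePlaces k) {z : k} (hz : z ≠ 0)
    (h : ∀ v ≠ u, ‖algebraMap k (v.adicCompletion k) z‖ = 1) :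
    ‖algebraMap k (u.adicCompletion k) z‖ = |(Algebra.norm ℚ z : ℝ)|⁻¹ := by
  have h1 := FinitePlace.prod_eq_inv_abs_norm hz
  rw [finprod_eq_single _ (FinitePlace.mk u) fun w hw => ?_] at h1
  · refine Eq.trans ?_ (h1.trans (by push_cast; rfl))
    rfl
  · rw [← FinitePlace.norm_embedding_eq]
    exact h _ fun hu => hw (by rw [← hu, FinitePlace.mk_maximalIdeal])

theorem prod_norm_embeddings (F : Type*) [Field F] [NumberField F] (a : F) :
    ∏ τ : F →+* ℂ, ‖τ a‖ = |(Algebra.norm ℚ a : ℝ)| := by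
  have h := congrArg norm (Algebra.norm_eq_prod_embeddings ℚ ℂ a)
  rw [norm_prod, eq_ratCast, Complex.norm_ratCast] at h
  rw [h]
  exact Fintype.prod_equiv (RingHom.equivRatAlgHom F ℂ) _ _ fun _ => rfl

/-- Product formula for an algebraic number which is a unit at all places above those different from
`u` and has only one absolute value above `u`. -/
theorem exists_prod_norm_embeddings_eq_zpow [NumberField L] (u : FinitePlaces k) {a : L}
    (ha : a ≠ 0) (hu : ∀ σ : AlgebraicClosure k ≃ₐ[k] AlgebraicClosure k,
      ‖placeEmbedding u (σ a)‖ = ‖placeEmbedding u (a : AlgebraicClosure k)‖)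
    (h : ∀ v ≠ u, ∀ σ : AlgebraicClosure k ≃ₐ[k] AlgebraicClosure k,
      ‖placeEmbedding v (σ a)‖ = 1) :
    ∃ m : ℤ, ∏ τ : L →+* ℂ, ‖τ a‖ = (Ideal.absNorm u.asIdeal : ℝ) ^ m ∧
      (m = 0 → ‖placeEmbedding u (a : AlgebraicClosure k)‖ = 1) := by
  have hz : Algebra.norm k a ≠ 0 := Algebra.norm_ne_zero_iff.2 ha
  have h1 : ‖algebraMap k (u.adicCompletion k) (Algebra.norm k a)‖ =
      (∏ τ : L →+* ℂ, ‖τ a‖)⁻¹ := by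
    rw [norm_eq_inv_abs_norm_of_forall_ne u hz fun v hv => ?_, Algebra.norm_norm,
      prod_norm_embeddings]
    rw [norm_placeEmbedding_norm v a 1 (h v hv), one_pow]
  -- The archimedean product is the inverse of the absolute value at u, hence the exponent -m below.
  obtain ⟨m, hm⟩ := exists_zpow_eq_norm u hz
  refine ⟨-m, ?_, fun h0 => ?_⟩
  · rw [zpow_neg, ← hm, h1, inv_inv]
  · rw [neg_eq_zero.1 h0, zpow_zero, norm_placeEmbedding_norm u a _ hu] at hm
    exact (pow_eq_one_iff_of_nonneg (norm_nonneg _) Module.finrank_pos.ne').1 hm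

end Norms

end

section

attribute [local instance] algClosureNormedField

/-! ### The second extension theorem -/

section SecondPart

/-- Lifting the values on a basis to ℝ turns the character into the exponential of a linear form,
which makes sense for real arguments as well. -/
theorem exists_circle_exp {n : ℕ} (φ : Multiplicative (Fin n → ℤ) →* Circle) :
    ∃ θ : Fin n → ℝ, ∀ c : Fin n → ℤ,
      φ (Multiplicative.ofAdd c) = Circle.exp (∑ i, θ i * c i) := by
  choose θ hθ using fun i : Fin n =>
    Circle.exp_surjective (φ (Multiplicative.ofAdd (Pi.single i 1)))
  let g : (Fin n → ℤ) →+ ℝ :=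
    { toFun c := ∑ i, θ i * c i
      map_zero' := by simp
      map_add' c d := by simp [mul_add, Finset.sum_add_distrib] }
  have h : Circle.expHom.comp g = MonoidHom.toAdditiveRight φ := by
    refine AddMonoidHom.functions_ext' _ _ _ fun i => AddMonoidHom.ext_int ?_
    have : g (Pi.single i 1) = θ i := by simp [g, Pi.single_apply]
    change Additive.ofMul (Circle.exp (g (Pi.single i 1))) = _
    rw [this, hθ]
    rfl
  exact ⟨θ, fun c => (DFunLike.congr_fun h c).symm⟩

variable {k A : Type*} [Field k] [NumberField k] [CommRing A] [HopfAlgebra k A] {n : ℕ}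
  (e : AlgebraicClosure k ⊗[k] A ≃ₐc[AlgebraicClosure k]
    SplitTorusRing (AlgebraicClosure k) n)

/-- Conjugating the value conjugates the character, and local absolute values are invariant under
that by `absChar_galAct`. -/
theorem norm_placeEmbedding_ratChar (u : FinitePlaces k)
    (h : SplitPartCompatible k A (u.adicCompletion k))
    (σ : AlgebraicClosure k ≃ₐ[k] AlgebraicClosure k) (γ : Points k A k) (c : Fin n → ℤ) :
    ‖placeEmbedding u (σ (ratChar e γ c))‖ = ‖placeEmbedding u (ratChar e γ c)‖ := by
  have : CharZero (u.adicCompletion k) :=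
    charZero_of_injective_algebraMap (algebraMap k (u.adicCompletion k)).injective
  rw [← ratChar_galAct, ← absChar_map_ofId, ← absChar_map_ofId]
  exact absChar_galAct e _ h σ _ c

/-- The archimedean sizes of the characters of a basis, as continuous functions on the archimedean
points. At the rational points which are units outside `u` they are powers of a fixed number. -/
theorem exists_archimedean_size (u : FinitePlaces k)
    (h : SplitPartCompatible k A (u.adicCompletion k)) (i : Fin n) :
    ∃ f : Points k A (InfiniteAdeleRing k) →* Multiplicative ℝ, Continuous f ∧
      ∀ γ ∈ rationalUnits A {u}, ∃ m : ℤ, f (Points.map (Algebra.ofId k _) γ) =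
        Multiplicative.ofAdd (m * Real.log (Ideal.absNorm u.asIdeal)) ∧
        (m = 0 → ‖placeEmbedding u (ratChar e γ (Pi.single i 1))‖ = 1) := by
  obtain ⟨L, hfin, hL⟩ := exists_splittingField e
  have : NumberField L := NumberField.of_module_finite k L
  choose X hX using fun τ : L →+* ℂ =>
    exists_archimedean_character_of_mem e L (Pi.single i 1) (fun γ => hL γ i) τ
  -- At a rational point this is log|N_{L/ℚ}(c(γ))|, written over the complex embeddings so that
  -- each term is defined on all archimedean points.
  let F (x : Points k A (InfiniteAdeleRing k)) : ℝ := ∑ τ : L →+* ℂ, Real.log ‖(X τ x : ℂ)‖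
  refine ⟨{ toFun x := Multiplicative.ofAdd (F x), map_one' := ?_, map_mul' x y := ?_ }, ?_,
    fun γ hγ => ?_⟩
  · simp [F]
  · rw [← ofAdd_add]
    congr 1
    simp only [F, map_mul, Units.val_mul, norm_mul]
    rw [← Finset.sum_add_distrib]
    exact Finset.sum_congr rfl fun τ _ => Real.log_mul (by simp) (by simp)
  · change Continuous F
    exact continuous_finsetSum _ fun τ _ => Continuous.log
      (Units.continuous_val.comp (X τ).continuous_toFun).norm fun x => by simp
  · have hne : (⟨_, hL γ i⟩ : L) ≠ 0 := fun h0 => by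
      have h1 := ratChar_add e γ (Pi.single i 1) (-Pi.single i 1)
      have h2 : ratChar e γ (Pi.single i 1) = 0 := congrArg Subtype.val h0
      rw [add_neg_cancel, ratChar_zero, h2, zero_mul] at h1
      exact one_ne_zero h1
    obtain ⟨m, hm, hm0⟩ := exists_prod_norm_embeddings_eq_zpow u hne
      (fun σ => norm_placeEmbedding_ratChar e u h σ γ _)
      (fun v hv σ => by
        rw [← ratChar_galAct]
        exact (mem_rationalUnits_iff e).1 hγ v (by simpa using hv) _)
    refine ⟨m, congrArg Multiplicative.ofAdd ?_, hm0⟩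
    have hF : F (Points.map (Algebra.ofId k _) γ) =
        ∑ τ : L →+* ℂ, Real.log ‖τ ⟨_, hL γ i⟩‖ :=
      Finset.sum_congr rfl fun τ _ => by rw [hX]
    rw [hF, ← Real.log_zpow, ← hm, Real.log_prod fun τ _ => by simpa using hne]

include e in
/-- Every character of the rational points which are units outside `u` is the restriction of a
continuous character of the archimedean points. -/
theorem exists_archimedean_extension_of_splitPartCompatible (u : FinitePlaces k)
    (h : SplitPartCompatible k A (u.adicCompletion k))
    (ψ : rationalUnits A ({u} : Set (FinitePlaces k)) →* Circle) :
    ∃ Ψ : Points k A (InfiniteAdeleRing k) →ₜ* Circle,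
      ∀ γ : rationalUnits A ({u} : Set (FinitePlaces k)),
        Ψ (Points.map (Algebra.ofId k _) (γ : Points k A k)) = ψ γ := by
  have hq : 0 < Real.log (Ideal.absNorm u.asIdeal) :=
    Real.log_pos (by exact_mod_cast HeightOneSpectrum.one_lt_absNorm u)
  have hle : rationalUnits A (∅ : Set (FinitePlaces k)) ≤ rationalUnits A {u} := fun γ hγ =>
    (mem_rationalUnits_iff e).2 fun v _ => (mem_rationalUnits_iff e).1 hγ v (Set.notMem_empty v)
  obtain ⟨Ψ₁, hΨ₁⟩ := exists_archimedean_extension e (ψ.comp (Subgroup.inclusion hle))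
  choose f hf hfm using exists_archimedean_size e u h
  choose m hm hm0 using fun i (γ : rationalUnits A ({u} : Set (FinitePlaces k))) =>
    hfm i γ.1 γ.2
  -- The vector of exponents of the archimedean sizes; it is additive because the sizes are
  -- multiplicative and log q ≠ 0.
  let M : rationalUnits A ({u} : Set (FinitePlaces k)) →* Multiplicative (Fin n → ℤ) :=
    MonoidHom.mk' (fun γ => Multiplicative.ofAdd fun i => m i γ) fun γ δ => by
      refine congrArg Multiplicative.ofAdd (funext fun i => ?_)
      have h1 : f i (Points.map (Algebra.ofId k _) ((γ * δ : rationalUnits A {u}) : Points k A k)) =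
          f i (Points.map (Algebra.ofId k _) (γ : Points k A k)) *
            f i (Points.map (Algebra.ofId k _) (δ : Points k A k)) := by
        rw [Subgroup.coe_mul, map_mul, map_mul]
      rw [hm, hm, hm, ← ofAdd_add, ← add_mul] at h1
      exact_mod_cast mul_right_cancel₀ hq.ne' (Multiplicative.ofAdd.injective h1)
  let p : rationalUnits A ({u} : Set (FinitePlaces k)) →* Points k A (InfiniteAdeleRing k) :=
    (Points.map (Algebra.ofId k _)).comp (Subgroup.subtype _)
  let ρ : rationalUnits A ({u} : Set (FinitePlaces k)) →* Circle :=
    ψ / (Ψ₁ : Points k A (InfiniteAdeleRing k) →* Circle).comp p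
  -- If all exponents vanish, the basis characters are units at u too, so γ is a unit everywhere,
  -- where `Ψ₁` already agrees with `ψ`.
  obtain ⟨φ, hφ⟩ := exists_circle_extension M ρ fun γ hγ => by
    have hmem : (γ : Points k A k) ∈ rationalUnits A (∅ : Set (FinitePlaces k)) := by
      refine mem_unitsOutside.2 fun v _ => ?_
      by_cases hv : v = u
      · subst hv
        rw [map_adeleFiniteProj_globalToAdelic,
          maxCompactSubgroup_eq_unitPoints e (placeEmbedding v), mem_unitPoints_iff_single]
        intro i
        rw [absChar_map_ofId]
        exact hm0 i γ (congrFun (congrArg Multiplicative.toAdd hγ) i)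
      · exact mem_unitsOutside.1 γ.2 v hv
    have h1 := hΨ₁ ⟨γ, hmem⟩
    change ψ γ / Ψ₁ (Points.map (Algebra.ofId k _) (γ : Points k A k)) = 1
    rw [h1]
    exact div_self' _
  obtain ⟨θ, hθ⟩ := exists_circle_exp φ
  -- The integer exponents are replaced by log(size)/log q, a real-valued continuous function on
  -- T(k_∞) which equals them at the rational points in question.
  let g (x : Points k A (InfiniteAdeleRing k)) : ℝ :=
    ∑ i, θ i * ((f i x).toAdd / Real.log (Ideal.absNorm u.asIdeal))
  let Ψ₂ : Points k A (InfiniteAdeleRing k) →ₜ* Circle :=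
    { toFun x := Circle.exp (g x)
      map_one' := by simp [g]
      map_mul' x y := by
        rw [← Circle.exp_add]
        congr 1
        simp only [g, map_mul, toAdd_mul, add_div, mul_add, Finset.sum_add_distrib]
      continuous_toFun := Circle.exp.continuous.comp (continuous_finsetSum _ fun i _ =>
        continuous_const.mul ((continuous_toAdd.comp (hf i)).div_const _)) }
  refine ⟨Ψ₁ * Ψ₂, fun γ => ?_⟩
  have h2 : Ψ₂ (p γ) = ρ γ := by
    rw [← hφ]
    refine Eq.trans ?_ (hθ _).symm
    refine congrArg Circle.exp (Finset.sum_congr rfl fun i _ => ?_)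
    change θ i * ((f i (Points.map (Algebra.ofId k _) (γ : Points k A k))).toAdd / _) = _
    rw [hm, toAdd_ofAdd, mul_div_cancel_right₀ _ hq.ne']
  change Ψ₁ (p γ) * Ψ₂ (p γ) = ψ γ
  rw [h2]
  exact mul_div_cancel _ _

include e in
theorem exists_automorphic_extension_localPoints (u : FinitePlaces k)
    (h : SplitPartCompatible k A (u.adicCompletion k)) (χu : LocalPoints k A u →ₜ* Circle) :
    ∃ χ : AdelicPoints k A →ₜ* Circle, IsAutomorphic χ ∧
      (∀ x : LocalPoints k A u, χ (localToAdelic u x) = χu x) ∧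
      ∀ v, v ≠ u → IsUnramifiedAt χ v := by
  let q : unitsOutside A ({u} : Set (FinitePlaces k)) →* LocalPoints k A u :=
    (Points.map (adeleFiniteProj u)).comp (Subgroup.subtype _)
  have hq : Continuous q :=
    (Points.continuous_map _ (continuous_adeleFiniteProj u)).comp continuous_subtype_val
  -- With U = {u} nothing is imposed at u, so the whole of T(k_u) lies in the open subgroup and `χu`
  -- can be used without restriction to its maximal compact subgroup.
  let θ : unitsOutside A ({u} : Set (FinitePlaces k)) →* Circle :=
    (χu : LocalPoints k A u →* Circle).comp q
  let g : rationalUnits A ({u} : Set (FinitePlaces k)) →*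
      unitsOutside A ({u} : Set (FinitePlaces k)) :=
    ((globalToAdelic k A).comp (rationalUnits A {u}).subtype).codRestrict _ fun γ => γ.2
  obtain ⟨Ψ, hΨ⟩ := exists_archimedean_extension_of_splitPartCompatible e u h (θ.comp g)⁻¹
  obtain ⟨χ, h1, h2⟩ := exists_isAutomorphic e θ (χu.continuous_toFun.comp hq) Ψ fun γ hγ => by
    rw [hΨ ⟨γ, hγ⟩, MonoidHom.inv_apply]
    exact mul_inv_cancel _
  refine ⟨χ, h1, fun x => ?_, fun v hv x hx => ?_⟩
  · have hx : localToAdelic u x ∈ unitsOutside A ({u} : Set (FinitePlaces k)) := by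
      refine mem_unitsOutside.2 fun v hv => ?_
      rw [map_adeleFiniteProj_localToAdelic_of_ne hv]
      exact one_mem _
    rw [h2 ⟨_, hx⟩ (map_adeleInfiniteProj_localToAdelic _ _)]
    exact congrArg χu (map_adeleFiniteProj_localToAdelic_self u x)
  · have hx' := localToAdelic_mem_unitsOutside hx {u}
    rw [h2 ⟨_, hx'⟩ (map_adeleInfiniteProj_localToAdelic _ _)]
    exact (congrArg χu (map_adeleFiniteProj_localToAdelic_of_ne hv.symm x)).trans (map_one χu)

end SecondPart

end

end TorusCharacters

end

theorem mainTheorem10 (k A : Type*) [Field k] [NumberField k] [CommRing A] [HopfAlgebra k A]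
    (hT : IsTorus k A) :
    (∀ (S : Finset (FinitePlaces k))
        (χS : maxCompactSubgroup (SemilocalPoints k A S) →ₜ* ℂˣ),
      ∃ χ' : AdelicPoints k A →ₜ* Circle, IsAutomorphic χ' ∧
        (∀ x : maxCompactSubgroup (SemilocalPoints k A S),
          (χ' (semilocalToAdelic S (x : SemilocalPoints k A S)) : ℂ) = (χS x : ℂ)) ∧
        ∀ v, v ∉ S → IsUnramifiedAt χ' v) ∧
    (∀ u₀ : FinitePlaces k, SplitPartCompatible k A (u₀.adicCompletion k) →
      ∀ χu₀ : LocalPoints k A u₀ →ₜ* Circle,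
      ∃ χ : AdelicPoints k A →ₜ* Circle, IsAutomorphic χ ∧
        (∀ x : LocalPoints k A u₀, χ (localToAdelic u₀ x) = χu₀ x) ∧
        ∀ v, v ≠ u₀ → IsUnramifiedAt χ v) := by
  obtain ⟨n, ⟨e⟩⟩ := hT
  exact ⟨fun S χS => exists_automorphic_extension_maxCompactSubgroup e S χS,
    fun u₀ h χu₀ => exists_automorphic_extension_localPoints e u₀ h χu₀⟩
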